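/- Throughout, $m\ge 1$, $\|z\|=(|z_1|^2+\cdots+|z_m|^2)^{1/2}$ on $\mathbb{C}^m$, $S_m(r)=\{z:\|z\|=r\}$, and $\eta_m=d^c\log\|z\|^2\wedge(dd^c\log\|z\|^2)^{m-1}$ with $d=\partial+\bar\partial$, $d^c=(4\pi\sqrt{-1})^{-1}(\partial-\bar\partial)$; on each sphere $S_m(r)$ the form $\eta_m$ is the normalised (total mass one) rotation invariant surface measure. Let $f$ be a meromorphic function on $\mathbb{C}^m$ with reduced representation $[f_0,f_1]$; that is, $f=f_0/f_1$ with $f_0,f_1$ entire, $f_1\not\equiv0$, whose only common entire factors are zero-free. Put $$T_f(r)=\int_{S_m(r)}\log\big(|f_0|^2+|f_1|^2\big)^{1/2}\,\eta_m-\int_{S_m(1)}\log\big(|f_0|^2+|f_1|^2\big)^{1/2}\,\eta_m .$$ A measurable set $A\subset\mathbb{R}$ has logarithmic density one if $\lim_{r\to\infty}\frac1{\log r}\int_{A\cap[1,r]}\frac{dt}{t}=1$. **Theorem.** Suppose that $f$ is nonconstant and of order zero, i.e. $\limsup_{r\to\infty}\log^+T_f(r)/\log r=0$. Let $\tilde q\in\mathbb{C}\setminus\{0\}$,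 $q=(\tilde q,\dots,\tilde q)$ and $qz=(\tilde q z_1,\dots,\tilde q z_m)$. Then $\log^+|f(qz)/f(z)|$ is integrable over $S_m(r)$ with respect to $\eta_m$ for every $r>0$, and there is a set $A$ of logarithmic density one such that $$m\Big(r,\frac{f(qz)}{f(z)}\Big)=\int_{S_m(r)}\log^+\Big|\frac{f(qz)}{f(z)}\Big|\,\eta_m(z)=o\big(T_f(r)\big)\qquad(r\to\infty,\ r\in A).$$ -/

import Mathlib

open MeasureTheory Filter Topology Asymptotics
open scoped Real

/-- The space `ℂ^m` with the norm `‖z‖ = (|z₁|² + ⋯ + |z_m|²)^{1/2}`. -/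
abbrev Cn (m : ℕ) : Type := EuclideanSpace ℂ (Fin m)

/-- The unitarily invariant probability measure on the unit sphere of `ℂ^m`: normalised surface
measure.  The form `η_m = dᶜ log ‖z‖² ∧ (ddᶜ log ‖z‖²)^{m-1}` restricts to this measure on the
unit sphere, and to its image under `ξ ↦ r ξ` on the sphere of radius `r`. -/
noncomputable def sphereMeasure (m : ℕ) : Measure (Metric.sphere (0 : Cn m) 1) :=
  ((volume : Measure (Cn m)).toSphere Set.univ)⁻¹ • (volume : Measure (Cn m)).toSphere

/-- `∫_{S_m(r)} u η_m`: the mean of `u` over the sphere of radius `r`. -/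
noncomputable def sphereMean {m : ℕ} (u : Cn m → ℝ) (r : ℝ) : ℝ :=
  ∫ ξ, u (r • (ξ : Cn m)) ∂(sphereMeasure m)

/-- Integrability of `u` over the sphere of radius `r` with respect to `η_m`. -/
def SphereIntegrable {m : ℕ} (u : Cn m → ℝ) (r : ℝ) : Prop :=
  Integrable (fun ξ : Metric.sphere (0 : Cn m) 1 => u (r • (ξ : Cn m))) (sphereMeasure m)

/-- The proximity function `m(r, h) = ∫_{S_m(r)} log⁺ |h| η_m`. -/
noncomputable def proximity {m : ℕ} (h : Cn m → ℂ) (r : ℝ) : ℝ :=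
  sphereMean (fun z => Real.posLog ‖h z‖) r

/-- Entire functions on `ℂ^m`. -/
def IsEntire {m : ℕ} (g : Cn m → ℂ) : Prop :=
  AnalyticOnNhd ℂ g Set.univ

/-- `f` is the meromorphic function `f₀ / f₁` on `ℂ^m`, in reduced representation: `f₀`, `f₁` are
entire, `f₁` does not vanish identically, and the only entire common factors of `f₀` and `f₁` are
units (zero-free functions).  The values of `f` on the zero set of `f₁` are immaterial. -/
structure IsReducedRepresentation {m : ℕ} (f f₀ f₁ : Cn m → ℂ) : Prop where
  entire_num : IsEntire f₀
  entire_den : IsEntire f₁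
  den_ne_zero : ∃ z, f₁ z ≠ 0
  coprime : ∀ d g₀ g₁ : Cn m → ℂ, IsEntire d → IsEntire g₀ → IsEntire g₁ →
    (∀ z, f₀ z = d z * g₀ z) → (∀ z, f₁ z = d z * g₁ z) → ∀ z, d z ≠ 0
  eq_div : ∀ z, f₁ z ≠ 0 → f z = f₀ z / f₁ z

/-- The Nevanlinna–Cartan characteristic function of the meromorphic function with reduced
representation `[f₀, f₁]`:
`T(r) = ∫_{S_m(r)} log ‖(f₀, f₁)‖ η_m - ∫_{S_m(1)} log ‖(f₀, f₁)‖ η_m`. -/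
noncomputable def characteristicT {m : ℕ} (f₀ f₁ : Cn m → ℂ) (r : ℝ) : ℝ :=
  sphereMean (fun z => Real.log (√(‖f₀ z‖ ^ 2 + ‖f₁ z‖ ^ 2))) r
    - sphereMean (fun z => Real.log (√(‖f₀ z‖ ^ 2 + ‖f₁ z‖ ^ 2))) 1

/-- The order `limsup_{r → ∞} log⁺ T(r) / log r` of a growth function, as an extended real. -/
noncomputable def growthOrder (T : ℝ → ℝ) : EReal :=
  limsup (fun r : ℝ => ((Real.posLog (T r) / Real.log r : ℝ) : EReal)) atTop

/-- The set `A` of radii has logarithmic density `δ`: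
`(1 / log r) ∫_{A ∩ [1, r]} dt / t → δ` as `r → ∞`. -/
def HasLogDensity (A : Set ℝ) (δ : ℝ) : Prop :=
  MeasurableSet A ∧
    Tendsto (fun r : ℝ => (∫ t in A ∩ Set.Icc 1 r, t⁻¹) / Real.log r) atTop (𝓝 δ)

/-! The argument bounds the proximity function by increments of spherical means and never counts
zeros. Write N₀, N₁, S for the spherical means of log|f₀|, log|f₁| and log‖(f₀,f₁)‖. On a complex
line through the origin, put a = r, b = qr and take R ≥ 2 max(r, |q|r). Poisson's inequality bounds
log|f₀(b)| and log|f₁(a)| by Poisson integrals over the circle of radius R. Exchanging the two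
kernels costs O(r/R) times the mean of |log|f₀/f₁||. What remains are the defects P_a log|f₀| −
log|f₀(a)| and P_b log|f₁| − log|f₁(b)|, which are nonnegative. Integrated over all lines they
become N₀(R) − N₀(r) and N₁(R) − N₁(|q|r), because the Poisson kernel has mean one and the sphere
measure is rotation invariant. This is `proximity_scaling_le`.

Take R = Kr. Order zero gives one set A of logarithmic density one on which T(Kr) ≤ 2T(r)
eventually, for every fixed K (`exists_hasLogDensity_one_le_two_mul`). So the kernel term is
O(T(r)/K), small for K large. The increments of N₀ and N₁ are o(T(r)) on A: these means are convex
in log r, so the increment over a ratio κ is at most 1/L of that over κ^L, which is O(T(r))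
(`eventually_increment_le`).

Constants are absorbed because T is unbounded. If T were bounded, N₀ and N₁ would be constant, and
the same estimate with R → ∞ would force f to be constant (`exists_eq_const_mul_of_sphereMean_le`).
-/

/-! ### Entire functions of one variable on discs and circles. -/

/-- An entire function `g ≢ 0` of one variable is, on a closed disc, a polynomial with roots in
the disc times a zero-free analytic function. -/
lemma exists_eq_prod_mul_of_entire {g : ℂ → ℂ} (hg : AnalyticOnNhd ℂ g Set.univ)
    (hne : ∃ z, g z ≠ 0) {R : ℝ} (hR : 0 < R) :
    ∃ (t : Finset ℂ) (n : ℂ → ℕ) (h : ℂ → ℂ), (∀ u ∈ t, u ∈ Metric.closedBall 0 R) ∧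
      AnalyticOnNhd ℂ h (Metric.closedBall 0 R) ∧ (∀ z ∈ Metric.closedBall 0 R, h z ≠ 0) ∧
      ∀ z ∈ Metric.closedBall 0 R, g z = (∏ u ∈ t, (z - u) ^ n u) * h z := by
  set B := Metric.closedBall (0 : ℂ) R
  have hgB : AnalyticOnNhd ℂ g B := hg.mono (Set.subset_univ _)
  have hord : ∀ u : B, meromorphicOrderAt g u ≠ ⊤ := by
    intro u hu
    rw [meromorphicOrderAt_eq_top_iff] at hu
    obtain ⟨z, hz⟩ := hne
    refine hz ?_
    exact (hg.eqOn_zero_of_preconnected_of_frequently_eq_zero isPreconnected_univ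
      (Set.mem_univ (u : ℂ)) hu.frequently) (Set.mem_univ z)
  have hfin := (MeromorphicOn.divisor g B).finiteSupport (isCompact_closedBall 0 R)
  obtain ⟨h, h1, h2, h3⟩ := hgB.meromorphicOn.extract_zeros_poles hord hfin
  have hpos : ∀ u, 0 ≤ MeromorphicOn.divisor g B u := by
    intro u
    exact (MeromorphicOn.AnalyticOnNhd.divisor_nonneg hgB) u
  set D := MeromorphicOn.divisor g B
  have hprod : (∏ᶠ u, (fun z : ℂ ↦ z - u) ^ D u) = fun z => ∏ u ∈ hfin.toFinset, (z - u) ^ (D u).toNat := by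
    rw [finprod_eq_prod_of_mulSupport_subset (s := hfin.toFinset)]
    · ext z
      rw [Finset.prod_apply]
      refine Finset.prod_congr rfl fun u _ => ?_
      simp only [Pi.pow_apply]
      rw [← zpow_natCast, Int.toNat_of_nonneg (hpos u)]
    · intro u hu
      simp only [Set.Finite.coe_toFinset, Function.mem_support]
      intro h0
      simp [h0] at hu
  refine ⟨hfin.toFinset, fun u => (D u).toNat, h, ?_, h1, fun z hz => h2 ⟨z, hz⟩, ?_⟩
  · intro u hu
    exact D.supportWithinDomain (by simpa using hu)
  · intro z hz
    rw [hprod] at h3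
    -- The closed disc has no isolated points, so equality off a discrete set gives equality on
    -- punctured neighbourhoods; continuity then gives it at `z`.
    have hev := (hgB.meromorphicOn z hz).eventuallyEq_nhdsNE_of_eventuallyEq_codiscreteWithin_preperfect
      (g := (fun z => ∏ u ∈ hfin.toFinset, (z - u) ^ (D u).toNat) • h)
      (MeromorphicAt.smul (by fun_prop) (h1 z hz).meromorphicAt) hz
      (by
        rw [show B = closure (Metric.ball 0 R) from (closure_ball _ hR.ne').symm]
        exact Metric.isOpen_ball.perfect_closure.2) h3
    have hc1 : ContinuousAt g z := (hgB z hz).continuousAt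
    have hc2 : ContinuousAt (fun z => (∏ u ∈ hfin.toFinset, (z - u) ^ (D u).toNat) * h z) z := by
      have := (h1 z hz).continuousAt
      fun_prop
    exact tendsto_nhds_unique_of_eventuallyEq (hc1.mono_left nhdsWithin_le_nhds)
      (hc2.mono_left nhdsWithin_le_nhds) hev

lemma log_norm_prod_mul {t : Finset ℂ} {n : ℂ → ℕ} {z c : ℂ}
    (h : (∏ u ∈ t, (z - u) ^ n u) * c ≠ 0) :
    Real.log ‖(∏ u ∈ t, (z - u) ^ n u) * c‖ = ∑ u ∈ t, n u * Real.log ‖z - u‖ + Real.log ‖c‖ := by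
  have h1 := left_ne_zero_of_mul h
  have h2 := right_ne_zero_of_mul h
  rw [norm_mul, Real.log_mul (norm_ne_zero_iff.2 h1) (norm_ne_zero_iff.2 h2), norm_prod,
    Real.log_prod (fun u hu => norm_ne_zero_iff.2 (Finset.prod_ne_zero_iff.1 h1 u hu))]
  simp [Real.log_pow]

lemma entire_zeros_inter_closedBall_finite {g : ℂ → ℂ} (hg : AnalyticOnNhd ℂ g Set.univ)
    (hne : ∃ z, g z ≠ 0) (R : ℝ) : ({z | g z = 0} ∩ Metric.closedBall 0 R).Finite := by
  rcases le_or_gt R 0 with hR | hR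
  · refine Set.Finite.subset (Set.finite_singleton (0 : ℂ)) ?_
    rintro z ⟨-, hz⟩
    have := (mem_closedBall_zero_iff.1 hz).trans hR
    simpa using this
  obtain ⟨t, n, h, -, -, h0, he⟩ := exists_eq_prod_mul_of_entire hg hne hR
  refine t.finite_toSet.subset ?_
  rintro z ⟨hz, hzR⟩
  rw [Set.mem_ofPred_eq, he z hzR, mul_eq_zero, or_iff_left (h0 z hzR), Finset.prod_eq_zero_iff] at hz
  obtain ⟨u, hu, hu0⟩ := hz
  rw [sub_eq_zero.1 (eq_zero_of_pow_eq_zero hu0)]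
  exact hu

lemma entire_circleMap_ne_zero_ae {g : ℂ → ℂ} (hg : AnalyticOnNhd ℂ g Set.univ)
    (hne : ∃ z, g z ≠ 0) {r : ℝ} (hr : r ≠ 0) : ∀ᵐ θ : ℝ, g (circleMap 0 r θ) ≠ 0 := by
  have hc := (entire_zeros_inter_closedBall_finite hg hne |r|).countable
  have := (hc.preimage_circleMap 0 hr).measure_zero volume
  refine measure_mono_null ?_ this
  intro θ hθ
  simp only [Set.mem_compl_iff, Set.mem_ofPred_eq, not_not] at hθ
  exact ⟨hθ, by simp⟩

lemma circleAverage_mono_ae {u v : ℂ → ℝ} {r : ℝ} (hu : CircleIntegrable u 0 r)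
    (hv : CircleIntegrable v 0 r) (h : ∀ᵐ θ : ℝ, u (circleMap 0 r θ) ≤ v (circleMap 0 r θ)) :
    Real.circleAverage u 0 r ≤ Real.circleAverage v 0 r := by
  simp only [Real.circleAverage_def, smul_eq_mul]
  refine mul_le_mul_of_nonneg_left ?_ (by positivity)
  exact intervalIntegral.integral_mono_ae Real.two_pi_pos.le hu hv h

lemma circleAverage_congr_ae {u v : ℂ → ℝ} {r : ℝ}
    (h : ∀ᵐ θ : ℝ, u (circleMap 0 r θ) = v (circleMap 0 r θ)) :
    Real.circleAverage u 0 r = Real.circleAverage v 0 r := by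
  simp only [Real.circleAverage_def]
  congr 1
  exact intervalIntegral.integral_congr_ae (h.mono fun _ h _ => h)

lemma entire_circleIntegrable_log_norm {g : ℂ → ℂ} (hg : AnalyticOnNhd ℂ g Set.univ) (r : ℝ) :
    CircleIntegrable (fun z => Real.log ‖g z‖) 0 r :=
  MeromorphicOn.circleIntegrable_log_norm (hg.mono (Set.subset_univ _)).meromorphicOn

/-! ### The Poisson kernel and Poisson's inequality. -/

lemma continuousOn_poissonKernel {w : ℂ} {R : ℝ} (hw : ‖w‖ < R) :
    ContinuousOn (poissonKernel 0 w) (Metric.sphere 0 |R|) := by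
  rw [poissonKernel_eq_re_herglotzRieszKernel]
  exact Complex.continuous_re.comp_continuousOn
    (continuousOn_herglotzRieszKernel_sphere (by simpa using hw))

lemma circleIntegrable_poissonKernel_mul {w : ℂ} {R : ℝ} (hw : ‖w‖ < R) {u : ℂ → ℝ}
    (hu : CircleIntegrable u 0 R) : CircleIntegrable (fun z => poissonKernel 0 w z * u z) 0 R :=
  CircleIntegrable.continuousOn_smul hu (continuousOn_poissonKernel hw)

lemma circleAverage_poissonKernel {w : ℂ} {R : ℝ} (hw : ‖w‖ < R) :
    Real.circleAverage (poissonKernel 0 w) 0 R = 1 := by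
  have h : InnerProductSpace.HarmonicOnNhd (fun _ : ℂ => (1 : ℝ)) (Metric.closedBall 0 R) := by
    intro x _
    exact InnerProductSpace.harmonicAt_const 1
  have := h.circleAverage_poissonKernel_smul (w := w) (by simpa using hw)
  convert this using 2
  ext z; simp

lemma poissonKernel_nonneg {w z : ℂ} {R : ℝ} (hw : ‖w‖ < R) (hz : ‖z‖ = R) :
    0 ≤ poissonKernel 0 w z := by
  rw [poissonKernel_def]
  simp only [sub_zero]
  have : ‖w‖ ^ 2 ≤ ‖z‖ ^ 2 := by rw [hz]; gcongr
  exact div_nonneg (by linarith) (by positivity)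

/-- Harnack's bounds (R ∓ |w|)/(R ± |w|) differ from 1 by at most 2|w|/(R − |w|), and R − |w| ≥ R/2.
-/
lemma abs_poissonKernel_sub_one_le {w z : ℂ} {R : ℝ} (hw : 2 * ‖w‖ ≤ R) (hR : 0 < R)
    (hz : ‖z‖ = R) : |poissonKernel 0 w z - 1| ≤ 4 * ‖w‖ / R := by
  have hw0 := norm_nonneg w
  have hwR : ‖w‖ < R := by linarith
  have h1 := re_herglotzRieszKernel_le (c := 0) (w := w) (z := z) (R := R) (by simpa using hz) (by simpa using hwR)
  have h2 := le_re_herglotzRieszKernel (c := 0) (w := w) (z := z) (R := R) (by simpa using hz) (by simpa using hwR)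
  have he : poissonKernel 0 w z = ((z - 0 + (w - 0)) / ((z - 0) - (w - 0))).re := by
    rw [poissonKernel_eq_re_herglotzRieszKernel]; rfl
  rw [← he, sub_zero] at h1 h2
  rw [abs_le]
  constructor
  · have : 1 - 4 * ‖w‖ / R ≤ (R - ‖w‖) / (R + ‖w‖) := by
      rw [le_div_iff₀ (by linarith), sub_mul, div_mul_eq_mul_div, one_mul, sub_le_comm,
        le_div_iff₀ hR]
      nlinarith
    linarith
  · have : (R + ‖w‖) / (R - ‖w‖) ≤ 1 + 4 * ‖w‖ / R := by
      rw [div_le_iff₀ (by linarith), add_mul, div_mul_eq_mul_div, one_mul, ← sub_le_iff_le_add',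
        le_div_iff₀ hR]
      nlinarith
    linarith

/-- The difference of the squares is (R² − |u|²)(R² − |w|²). -/
lemma norm_sub_mul_le_norm_sq_sub {u w : ℂ} {R : ℝ} (hu : ‖u‖ ≤ R) (hw : ‖w‖ ≤ R) :
    R * ‖w - u‖ ≤ ‖(R : ℂ) ^ 2 - starRingEnd ℂ u * w‖ := by
  refine le_of_sq_le_sq ?_ (norm_nonneg _)
  rw [mul_pow, ← Complex.normSq_eq_norm_sq, ← Complex.normSq_eq_norm_sq]
  have hu' : ‖u‖ ^ 2 ≤ R ^ 2 := by gcongr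
  have hw' : ‖w‖ ^ 2 ≤ R ^ 2 := by gcongr
  rw [← Complex.normSq_eq_norm_sq, Complex.normSq_apply] at hu' hw'
  simp only [Complex.normSq_apply, Complex.sub_re, Complex.sub_im, Complex.mul_re, Complex.mul_im,
    Complex.conj_re, Complex.conj_im, pow_two, Complex.ofReal_re, Complex.ofReal_im]
  nlinarith [mul_nonneg (sub_nonneg.2 hu') (sub_nonneg.2 hw')]

lemma norm_sub_mul_eq_norm_sq_sub {u z : ℂ} {R : ℝ} (hR : 0 ≤ R) (hz : ‖z‖ = R) :
    R * ‖z - u‖ = ‖(R : ℂ) ^ 2 - starRingEnd ℂ u * z‖ := by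
  refine (sq_eq_sq₀ (by positivity) (norm_nonneg _)).1 ?_
  rw [mul_pow, ← Complex.normSq_eq_norm_sq, ← Complex.normSq_eq_norm_sq]
  have hw' : ‖z‖ ^ 2 = R ^ 2 := by rw [hz]
  rw [← Complex.normSq_eq_norm_sq, Complex.normSq_apply] at hw'
  simp only [Complex.normSq_apply, Complex.sub_re, Complex.sub_im, Complex.mul_re, Complex.mul_im,
    Complex.conj_re, Complex.conj_im, pow_two, Complex.ofReal_re, Complex.ofReal_im]
  linear_combination (R^2 - u.re^2-u.im^2) * hw'

/-- For |u| < R, the function log|R² − ūz| − log R is harmonic on the disc, agrees with log|z − u|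
on the circle and majorises it inside. For |u| = R equality holds. -/
lemma log_norm_sub_le_circleAverage {u w : ℂ} {R : ℝ} (hu : ‖u‖ ≤ R) (hw : ‖w‖ < R)
    (hwu : w ≠ u) :
    Real.log ‖w - u‖ ≤
      Real.circleAverage (fun z => poissonKernel 0 w z * Real.log ‖z - u‖) 0 R := by
  have hR : 0 < R := (norm_nonneg w).trans_lt hw
  have hwu' : 0 < ‖w - u‖ := norm_pos_iff.2 (sub_ne_zero.2 hwu)
  rcases hu.eq_or_lt with hu | hu
  · refine le_of_eq ?_
    rw [← circleAverage_re_herglotzRieszKernel_mul_log₀ (w := w) (ρ := u) (R := R)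
      (by simpa using hu) (by simpa using hw), ← poissonKernel_eq_re_herglotzRieszKernel]
    rfl
  · set v : ℂ → ℝ := fun z => Real.log ‖(R : ℂ) ^ 2 - starRingEnd ℂ u * z‖ - Real.log R
    have hv : InnerProductSpace.HarmonicOnNhd v (Metric.closedBall 0 R) := by
      intro z hz
      have hne : (R : ℂ) ^ 2 - starRingEnd ℂ u * z ≠ 0 := by
        intro h
        have h1 : ‖(R : ℂ) ^ 2‖ = ‖starRingEnd ℂ u * z‖ := by rw [sub_eq_zero.1 h]
        simp only [norm_pow, Complex.norm_real, norm_mul, RCLike.norm_conj, Real.norm_eq_abs, sq_abs] at h1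
        have hz' : ‖z‖ ≤ R := by simpa using hz
        have h2 := mul_le_mul_of_nonneg_left hz' (norm_nonneg u)
        have h3 := mul_lt_mul_of_pos_right hu hR
        nlinarith
      have h1 : InnerProductSpace.HarmonicAt (fun z => Real.log ‖(R : ℂ) ^ 2 - starRingEnd ℂ u * z‖) z :=
        AnalyticAt.harmonicAt_log_norm (by fun_prop) hne
      exact h1.sub (InnerProductSpace.harmonicAt_const _)
    have h1 := hv.circleAverage_poissonKernel_smul (w := w) (by simpa using hw)
    have h2 : Real.circleAverage (fun z => poissonKernel 0 w z * Real.log ‖z - u‖) 0 R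
        = Real.circleAverage (poissonKernel 0 w • v) 0 R := by
      refine Real.circleAverage_congr_sphere fun z hz => ?_
      have hz : ‖z‖ = R := by simpa [abs_of_pos hR] using hz
      have hzu : ‖z - u‖ ≠ 0 := by
        rw [norm_ne_zero_iff, sub_ne_zero]; rintro rfl; linarith
      simp only [Pi.smul_apply', smul_eq_mul, v]
      rw [← norm_sub_mul_eq_norm_sq_sub hR.le hz, Real.log_mul hR.ne' hzu]
      ring
    rw [h2, h1]
    have := Real.log_le_log (mul_pos hR hwu') (norm_sub_mul_le_norm_sq_sub hu.le hw.le)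
    rw [Real.log_mul hR.ne' hwu'.ne'] at this
    simp only [v]; linarith

/-- Poisson's inequality for the subharmonic function `log ‖g‖`. -/
lemma log_norm_le_circleAverage_poissonKernel {g : ℂ → ℂ} (hg : AnalyticOnNhd ℂ g Set.univ)
    {w : ℂ} {R : ℝ} (hw : ‖w‖ < R) (hgw : g w ≠ 0) :
    Real.log ‖g w‖ ≤
      Real.circleAverage (fun z => poissonKernel 0 w z * Real.log ‖g z‖) 0 R := by
  have hR : 0 < R := (norm_nonneg w).trans_lt hw
  obtain ⟨t, n, h, ht, ha, h0, he⟩ := exists_eq_prod_mul_of_entire hg ⟨w, hgw⟩ hR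
  have hwB : w ∈ Metric.closedBall 0 R := by simpa using hw.le
  have hsplit : ∀ z ∈ Metric.closedBall 0 R, g z ≠ 0 → Real.log ‖g z‖ =
      ∑ u ∈ t, n u * Real.log ‖z - u‖ + Real.log ‖h z‖ := by
    intro z hz hgz
    rw [he z hz] at hgz ⊢
    exact log_norm_prod_mul hgz
  have hh : InnerProductSpace.HarmonicOnNhd (fun z => Real.log ‖h z‖) (Metric.closedBall 0 R) :=
    fun z hz => (ha z hz).harmonicAt_log_norm (h0 z hz)
  have hhP := hh.circleAverage_poissonKernel_smul (w := w) (by simpa using hw)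
  have hhI : CircleIntegrable (fun z => Real.log ‖h z‖) 0 R := by
    refine MeromorphicOn.circleIntegrable_log_norm ?_
    rw [abs_of_pos hR]
    exact (ha.mono Metric.sphere_subset_closedBall).meromorphicOn
  have hsI : ∀ u ∈ t, CircleIntegrable
      (fun z => (n u : ℝ) * (poissonKernel 0 w z * Real.log ‖z - u‖)) 0 R := fun u _ =>
    (circleIntegrable_poissonKernel_mul hw (circleIntegrable_log_norm_sub_const R)).const_mul _
  have heq : Real.circleAverage (fun z => poissonKernel 0 w z * Real.log ‖g z‖) 0 R
      = ∑ u ∈ t, n u * Real.circleAverage (fun z => poissonKernel 0 w z * Real.log ‖z - u‖) 0 R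
        + Real.log ‖h w‖ := by
    rw [← hhP]
    have : ∀ u, (n u : ℝ) * Real.circleAverage (fun z => poissonKernel 0 w z * Real.log ‖z - u‖) 0 R
        = Real.circleAverage (fun z => (n u : ℝ) * (poissonKernel 0 w z * Real.log ‖z - u‖)) 0 R := by
      intro u
      rw [← smul_eq_mul, ← Real.circleAverage_fun_smul]; rfl
    simp_rw [this]
    rw [← Real.circleAverage_fun_sum hsI, ← Real.circleAverage_fun_add ?_ ?_]
    · refine circleAverage_congr_ae ?_
      filter_upwards [entire_circleMap_ne_zero_ae hg ⟨w, hgw⟩ hR.ne'] with θ hθ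
      rw [hsplit _ (by simp [abs_of_pos hR]) hθ]
      simp only [Pi.smul_apply', smul_eq_mul, mul_add, Finset.mul_sum]
      congr 1
      exact Finset.sum_congr rfl fun u _ => by ring
    · exact CircleIntegrable.fun_sum _ hsI
    · exact circleIntegrable_poissonKernel_mul hw hhI
  rw [heq, hsplit w hwB hgw]
  refine add_le_add_left (Finset.sum_le_sum fun u hu => ?_) _
  -- A point of `t` with exponent zero may equal `w`; a genuine root cannot, since `g w ≠ 0`.
  by_cases hn : n u = 0
  · simp [hn]
  refine mul_le_mul_of_nonneg_left (log_norm_sub_le_circleAverage (by simpa using ht u hu) hw ?_)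
    (by positivity)
  rintro rfl
  apply hgw
  rw [he w hwB, Finset.prod_eq_zero hu (by simp [hn]), zero_mul]

/-! ### Convexity and monotonicity of circle means in log r. -/

/-- For x ≠ 0 the function is max(t, log x). With x = |u| it is the mean of log|z − u| over the
circle of radius exp t. -/
lemma convexOn_add_posLog (x : ℝ) :
    ConvexOn ℝ Set.univ (fun t : ℝ => t + Real.posLog ((Real.exp t)⁻¹ * x)) := by
  rcases eq_or_ne x 0 with rfl | hx
  · simpa using! convexOn_id (convex_univ (𝕜 := ℝ) (E := ℝ))
  have : (fun t : ℝ => t + Real.posLog ((Real.exp t)⁻¹ * x)) = fun t => max t (Real.log x) := by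
    ext t
    simp only [Real.posLog]
    rw [Real.log_mul (by positivity) hx, Real.log_inv, Real.log_exp]
    rcases le_total t (Real.log x) with h | h
    · rw [max_eq_right h, max_eq_right (by linarith)]; ring
    · rw [max_eq_left h, max_eq_left (by linarith)]; ring
  rw [this]
  exact (convexOn_id convex_univ).sup (convexOn_const _ convex_univ)

/-- Circle averages of `log ‖g‖` are convex functions of `log r`. -/
lemma convexOn_circleAverage_log_norm {g : ℂ → ℂ} (hg : AnalyticOnNhd ℂ g Set.univ)
    (hne : ∃ z, g z ≠ 0) :
    ConvexOn ℝ Set.univ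
      (fun t : ℝ => Real.circleAverage (fun z => Real.log ‖g z‖) 0 (Real.exp t)) := by
  -- The factorisation lives on a single disc, so Jensen's formula gives convexity only up to its
  -- radius exp T. Convexity involves two points at a time, so this suffices.
  have key : ∀ T : ℝ, ConvexOn ℝ (Set.Iic T)
      (fun t : ℝ => Real.circleAverage (fun z => Real.log ‖g z‖) 0 (Real.exp t)) := by
    intro T
    obtain ⟨t, n, h, ht, ha, h0, he⟩ := exists_eq_prod_mul_of_entire hg hne (Real.exp_pos T)
    have hform : Set.EqOn (fun s : ℝ => ∑ u ∈ t, (n u : ℝ) * (s + Real.posLog ((Real.exp s)⁻¹ * ‖u‖))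
          + Real.log ‖h 0‖)
        (fun s : ℝ => Real.circleAverage (fun z => Real.log ‖g z‖) 0 (Real.exp s)) (Set.Iic T) := by
      intro s hs
      have hs : Real.exp s ≤ Real.exp T := Real.exp_le_exp.2 hs
      have hsub : Metric.closedBall (0 : ℂ) |Real.exp s| ⊆ Metric.closedBall 0 (Real.exp T) :=
        Metric.closedBall_subset_closedBall (by rwa [abs_of_pos (Real.exp_pos s)])
      have ha' := ha.mono hsub
      have hI : CircleIntegrable (fun z => Real.log ‖h z‖) 0 (Real.exp s) :=
        MeromorphicOn.circleIntegrable_log_norm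
          (ha'.mono Metric.sphere_subset_closedBall).meromorphicOn
      have hsI : ∀ u ∈ t, CircleIntegrable
          (fun z => (n u : ℝ) * Real.log ‖z - u‖) 0 (Real.exp s) := fun u _ =>
        (circleIntegrable_log_norm_sub_const _).const_mul _
      have h1 : Real.circleAverage (fun z => Real.log ‖g z‖) 0 (Real.exp s) =
          Real.circleAverage (fun z => ∑ u ∈ t, n u * Real.log ‖z - u‖ + Real.log ‖h z‖) 0
            (Real.exp s) := by
        refine circleAverage_congr_ae ?_
        filter_upwards [entire_circleMap_ne_zero_ae hg hne (Real.exp_pos s).ne'] with θ hθ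
        have hmem : circleMap 0 (Real.exp s) θ ∈ Metric.closedBall (0 : ℂ) (Real.exp T) := by
          simpa using hs
        rw [he _ hmem] at hθ ⊢
        exact log_norm_prod_mul hθ
      simp only
      rw [h1, Real.circleAverage_fun_add (CircleIntegrable.fun_sum _ hsI) hI,
        Real.circleAverage_fun_sum hsI,
        ha'.circleAverage_log_norm_of_ne_zero (fun z hz => h0 z (hsub hz))]
      congr 1
      refine Finset.sum_congr rfl fun u _ => ?_
      have := Real.circleAverage_fun_smul (𝕜 := ℝ) (a := (n u : ℝ)) (c := 0) (R := Real.exp s)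
        (f := fun z : ℂ => Real.log ‖z - u‖)
      simp only [smul_eq_mul] at this
      rw [this, circleAverage_log_norm_sub_const_eq_log_radius_add_posLog (Real.exp_pos s).ne']
      simp
    refine ConvexOn.congr ?_ hform
    refine ConvexOn.add ?_ (convexOn_const _ (convex_Iic T))
    have : ConvexOn ℝ Set.univ
        (fun s : ℝ => ∑ u ∈ t, (n u : ℝ) * (s + Real.posLog ((Real.exp s)⁻¹ * ‖u‖))) := by
      refine ⟨convex_univ, fun x _ y _ a b ha' hb hab => ?_⟩
      simp only [smul_eq_mul, Finset.mul_sum]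
      rw [← Finset.sum_add_distrib]
      refine Finset.sum_le_sum fun u _ => ?_
      have := mul_le_mul_of_nonneg_left
        ((convexOn_add_posLog ‖u‖).2 (Set.mem_univ x) (Set.mem_univ y) ha' hb hab)
        (Nat.cast_nonneg (α := ℝ) (n u))
      simp only [smul_eq_mul] at this
      linarith
    exact this.subset (Set.subset_univ _) (convex_Iic T)
  refine ⟨convex_univ, fun x _ y _ a b ha hb hab => ?_⟩
  exact (key (max x y)).2 (le_max_left x y) (le_max_right x y) ha hb hab

lemma ConvexOn.monotone_of_le_of_le {φ : ℝ → ℝ} (hφ : ConvexOn ℝ Set.univ φ) {B t₀ : ℝ}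
    (hB : ∀ t ≤ t₀, φ t ≤ B) : Monotone φ := by
  refine monotone_iff_forall_lt.2 fun x y hxy => ?_
  by_contra! hlt
  set δ := (φ x - φ y) / (y - x)
  have hδ : 0 < δ := div_pos (by linarith) (by linarith)
  -- Far enough left that a line of slope −δ through (x, φ x) exceeds B at `z`.
  set z := min t₀ (x - (|B - φ x| + 1) / δ)
  have hzx : z < x := (min_le_right _ _).trans_lt
    (sub_lt_self _ (div_pos (by positivity) hδ))
  have h1 := hφ.slope_mono_adjacent (Set.mem_univ z) (Set.mem_univ y) hzx hxy
  have h2 : (φ y - φ x) / (y - x) = -δ := by rw [← neg_sub, neg_div]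
  rw [h2, div_le_iff₀ (by linarith)] at h1
  have h3 : (|B - φ x| + 1) / δ ≤ x - z := by
    have : z ≤ x - (|B - φ x| + 1) / δ := min_le_right _ _
    linarith
  rw [div_le_iff₀ hδ] at h3
  have := hB z (min_le_left _ _)
  have := le_abs_self (B - φ x)
  nlinarith

lemma ConvexOn.eq_of_forall_le {φ : ℝ → ℝ} (hφ : ConvexOn ℝ Set.univ φ) {B : ℝ}
    (hB : ∀ t, φ t ≤ B) (x y : ℝ) : φ x = φ y := by
  have h1 : Monotone φ := hφ.monotone_of_le_of_le (t₀ := 0) fun t _ => hB t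
  have hneg : ConvexOn ℝ Set.univ (fun t => φ (-t)) := by
    refine ⟨convex_univ, fun x _ y _ a b ha hb hab => ?_⟩
    have := hφ.2 (Set.mem_univ (-x)) (Set.mem_univ (-y)) ha hb hab
    convert this using 2
    simp only [smul_eq_mul]; ring
  have h2 : Monotone (fun t => φ (-t)) := hneg.monotone_of_le_of_le (t₀ := 0) fun t _ => hB _
  have h3 : Antitone φ := fun a b hab => by simpa using h2 (neg_le_neg hab)
  rcases le_total x y with h | h
  · exact le_antisymm (h1 h) (h3 h)
  · exact le_antisymm (h3 h) (h1 h)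

lemma exists_log_norm_le_of_continuous {E : Type*} [NormedAddCommGroup E] [ProperSpace E]
    {g : E → ℂ} (hg : Continuous g) (R : ℝ) :
    ∃ C : ℝ, 0 ≤ C ∧ ∀ z, ‖z‖ ≤ R → Real.posLog ‖g z‖ ≤ C := by
  obtain ⟨C, hC⟩ := (isCompact_closedBall (0 : E) R).exists_bound_of_continuousOn hg.continuousOn
  refine ⟨Real.posLog C, Real.posLog_nonneg, fun z hz => ?_⟩
  exact Real.posLog_le_posLog (norm_nonneg _) (hC z (by simpa using hz))

lemma log_le_posLog (x : ℝ) : Real.log x ≤ Real.posLog x := le_max_right _ _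

lemma circleAverage_log_norm_mono {g : ℂ → ℂ} (hg : AnalyticOnNhd ℂ g Set.univ)
    (hne : ∃ z, g z ≠ 0) {r s : ℝ} (hr : 0 < r) (hrs : r ≤ s) :
    Real.circleAverage (fun z => Real.log ‖g z‖) 0 r ≤
      Real.circleAverage (fun z => Real.log ‖g z‖) 0 s := by
  have hc := convexOn_circleAverage_log_norm hg hne
  have hgc : Continuous g := continuousOn_univ.1 hg.continuousOn
  obtain ⟨C, -, hC⟩ := exists_log_norm_le_of_continuous hgc 1
  have hm := hc.monotone_of_le_of_le (t₀ := 0) (B := C) fun t ht => by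
    refine Real.circleAverage_mono_on_of_le_circle (entire_circleIntegrable_log_norm hg _) ?_
    intro z hz
    refine (log_le_posLog _).trans (hC z ?_)
    have : ‖z‖ = Real.exp t := by simpa using hz
    rw [this]
    exact Real.exp_le_one_iff.2 ht
  have := hm (Real.log_le_log hr hrs)
  simpa only [Real.exp_log hr, Real.exp_log (hr.trans_le hrs)] using this

/-! ### Rotation invariance of the sphere measure and slicing by complex lines. -/

instance sphereMeasure_isFiniteMeasure {m : ℕ} : IsFiniteMeasure (sphereMeasure m) := by
  unfold sphereMeasure
  rcases eq_or_ne ((volume : Measure (Cn m)).toSphere) 0 with h | h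
  · rw [h]; simp; infer_instance
  · constructor
    rw [Measure.smul_apply, smul_eq_mul]
    exact ENNReal.mul_lt_top (ENNReal.inv_lt_top.2 (pos_iff_ne_zero.2
      (Measure.measure_univ_ne_zero.2 h))) (measure_lt_top _ _)

instance sphereMeasure_isProbabilityMeasure {m : ℕ} [NeZero m] :
    IsProbabilityMeasure (sphereMeasure m) := by
  have h : (volume : Measure (Cn m)).toSphere ≠ 0 := Measure.toSphere_ne_zero _
  constructor
  unfold sphereMeasure
  rw [Measure.smul_apply, smul_eq_mul]
  exact ENNReal.inv_mul_cancel (Measure.measure_univ_ne_zero.2 h) (measure_ne_top _ _)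

instance sphereMeasure_isOpenPosMeasure {m : ℕ} : (sphereMeasure m).IsOpenPosMeasure := by
  constructor
  intro U hU hne
  unfold sphereMeasure
  rw [Measure.smul_apply, smul_eq_mul]
  exact mul_ne_zero (ENNReal.inv_ne_zero.2 (measure_ne_top _ _)) (hU.measure_ne_zero _ hne)

/-- Multiplication by `exp (iθ)` on `ℂ^m`, as a real linear isometry. -/
noncomputable def expSMul (m : ℕ) (θ : ℝ) : Cn m ≃ₗᵢ[ℝ] Cn m :=
  { (LinearEquiv.smulOfNeZero ℂ (Cn m) (Complex.exp (θ * Complex.I))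
      (Complex.exp_ne_zero _)).restrictScalars ℝ with
    norm_map' := fun x => by simp [norm_smul, Complex.norm_exp_ofReal_mul_I] }

lemma expSMul_apply {m : ℕ} (θ : ℝ) (z : Cn m) :
    expSMul m θ z = Complex.exp (θ * Complex.I) • z := rfl

/-- Multiplication by `exp (iθ)` on the unit sphere. -/
noncomputable def sphereRot {m : ℕ} (θ : ℝ) (ξ : Metric.sphere (0 : Cn m) 1) :
    Metric.sphere (0 : Cn m) 1 :=
  ⟨Complex.exp (θ * Complex.I) • (ξ : Cn m), by
    simp [norm_smul, Complex.norm_exp_ofReal_mul_I]⟩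

lemma coe_sphereRot {m : ℕ} (θ : ℝ) (ξ : Metric.sphere (0 : Cn m) 1) :
    (sphereRot θ ξ : Cn m) = Complex.exp (θ * Complex.I) • (ξ : Cn m) := rfl

lemma continuous_sphereRot {m : ℕ} :
    Continuous (fun p : ℝ × Metric.sphere (0 : Cn m) 1 => sphereRot p.1 p.2) := by
  refine Continuous.subtype_mk ?_ _
  fun_prop

lemma circleMap_smul_eq {m : ℕ} (r θ : ℝ) (ξ : Metric.sphere (0 : Cn m) 1) :
    circleMap 0 r θ • (ξ : Cn m) = r • (sphereRot θ ξ : Cn m) := by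
  rw [coe_sphereRot, circleMap, zero_add, mul_smul, Complex.coe_smul]

open scoped Pointwise in
lemma measurePreserving_sphereRot {m : ℕ} (θ : ℝ) :
    MeasurePreserving (sphereRot θ) (sphereMeasure m) (sphereMeasure m) := by
  have hcont : Continuous (sphereRot (m := m) θ) :=
    continuous_sphereRot.comp (Continuous.prodMk_right θ)
  have h : MeasurePreserving (sphereRot θ) (volume : Measure (Cn m)).toSphere
      (volume : Measure (Cn m)).toSphere := by
    refine ⟨hcont.measurable, ?_⟩
    ext s hs
    rw [Measure.map_apply hcont.measurable hs, Measure.toSphere_apply' _ (hcont.measurable hs),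
      Measure.toSphere_apply' _ hs]
    congr 1
    -- The sphere measure of `s` is read off from the Lebesgue measure of the cone over `s`, which
    -- the isometry preserves.
    have : Set.Ioo (0 : ℝ) 1 • ((↑) '' (sphereRot θ ⁻¹' s) : Set (Cn m))
        = expSMul m θ ⁻¹' (Set.Ioo (0 : ℝ) 1 • ((↑) '' s : Set (Cn m))) := by
      ext z
      simp only [Set.mem_smul, Set.mem_image, Set.mem_preimage]
      constructor
      · rintro ⟨a, ha, _, ⟨ξ, hξ, rfl⟩, rfl⟩
        exact ⟨a, ha, _, ⟨_, hξ, rfl⟩, by rw [coe_sphereRot, map_smul]; rfl⟩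
      · rintro ⟨a, ha, _, ⟨η, hη, rfl⟩, hz⟩
        have hinv : sphereRot θ (sphereRot (-θ) η) = η := by
          ext1
          rw [coe_sphereRot, coe_sphereRot, smul_smul, ← Complex.exp_add]
          simp
        refine ⟨a, ha, _, ⟨sphereRot (-θ) η, by rwa [hinv], rfl⟩, ?_⟩
        apply (expSMul m θ).injective
        rw [← hz, map_smul, expSMul_apply, ← coe_sphereRot, hinv]
    rw [this]
    exact (expSMul m θ).measurePreserving.measure_preimage_emb
      (expSMul m θ).toHomeomorph.measurableEmbedding _
  exact h.smul_measure _

/-- Averaging over the orbits of a measure preserving family of maps. -/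
lemma lintegral_lintegral_comp_eq {X : Type*} [MeasurableSpace X] {μ : Measure X} [SFinite μ]
    {ν : Measure ℝ} [SFinite ν]
    {a : ℝ → X → X} (ha : Measurable (Function.uncurry a)) (hp : ∀ θ, MeasurePreserving (a θ) μ μ)
    {F : X → ENNReal} (hF : Measurable F) :
    ∫⁻ x, ∫⁻ θ, F (a θ x) ∂ν ∂μ = ν Set.univ * ∫⁻ x, F x ∂μ := by
  have hm : AEMeasurable (Function.uncurry fun x θ => F (a θ x)) (μ.prod ν) :=
    (hF.comp (ha.comp measurable_swap)).aemeasurable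
  rw [lintegral_lintegral_swap hm]
  have : ∀ θ, ∫⁻ x, F (a θ x) ∂μ = ∫⁻ x, F x ∂μ := fun θ => (hp θ).lintegral_comp hF
  simp_rw [this, lintegral_const, mul_comm]

lemma measurePreserving_prod_sphereRot {m : ℕ} (ν : Measure ℝ) [SFinite ν] :
    MeasurePreserving (fun p : ℝ × Metric.sphere (0 : Cn m) 1 => (p.1, sphereRot p.1 p.2))
      (ν.prod (sphereMeasure m)) (ν.prod (sphereMeasure m)) :=
  (MeasurePreserving.id ν).skew_product (g := sphereRot) continuous_sphereRot.measurable
    (ae_of_all _ fun θ => (measurePreserving_sphereRot θ).map_eq)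

lemma circleAverage_mul_eq_integral {m : ℕ} (k : ℂ → ℝ) (U : Cn m → ℝ) (r : ℝ)
    (ξ : Metric.sphere (0 : Cn m) 1) :
    Real.circleAverage (fun w => k w * U (w • (ξ : Cn m))) 0 r =
      (2 * π)⁻¹ * ∫ θ in Set.Ioc 0 (2 * π), k (circleMap 0 r θ) * U (r • (sphereRot θ ξ : Cn m)) := by
  rw [Real.circleAverage_def, intervalIntegral.integral_of_le Real.two_pi_pos.le, smul_eq_mul]
  simp_rw [circleMap_smul_eq]

lemma integrable_prod_circleMap {m : ℕ} {k : ℂ → ℝ} {U : Cn m → ℝ} {r : ℝ}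
    (hk : ContinuousOn k (Metric.sphere 0 |r|)) (hU : SphereIntegrable U r) :
    Integrable (fun p : ℝ × Metric.sphere (0 : Cn m) 1 =>
        k (circleMap 0 r p.1) * U (r • (sphereRot p.1 p.2 : Cn m)))
      ((volume.restrict (Set.Ioc 0 (2 * π))).prod (sphereMeasure m)) := by
  have hk' : Integrable (fun θ => k (circleMap 0 r θ)) (volume.restrict (Set.Ioc 0 (2 * π))) := by
    have := (hk.circleIntegrable' : CircleIntegrable k 0 r)
    exact (intervalIntegrable_iff_integrableOn_Ioc_of_le Real.two_pi_pos.le).1 this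
  have h := hk'.mul_prod hU
  exact (measurePreserving_prod_sphereRot _).integrable_comp_of_integrable h

lemma integrable_circleAverage_mul {m : ℕ} {k : ℂ → ℝ} {U : Cn m → ℝ} {r : ℝ}
    (hk : ContinuousOn k (Metric.sphere 0 |r|)) (hU : SphereIntegrable U r) :
    Integrable (fun ξ : Metric.sphere (0 : Cn m) 1 =>
      Real.circleAverage (fun w => k w * U (w • (ξ : Cn m))) 0 r) (sphereMeasure m) := by
  simp_rw [circleAverage_mul_eq_integral]
  exact (integrable_prod_circleMap hk hU).integral_prod_right.const_mul _

/-- Under the measure preserving skew map (θ, ξ) ↦ (θ, exp(iθ)ξ) the integrand becomes a product,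
and Fubini separates the kernel from `U`. This turns disc estimates into estimates of spherical
means. -/
lemma integral_circleAverage_mul {m : ℕ} {k : ℂ → ℝ} {U : Cn m → ℝ} {r : ℝ}
    (hk : ContinuousOn k (Metric.sphere 0 |r|)) (hU : SphereIntegrable U r) :
    ∫ ξ : Metric.sphere (0 : Cn m) 1,
      Real.circleAverage (fun w => k w * U (w • (ξ : Cn m))) 0 r ∂(sphereMeasure m) =
    Real.circleAverage k 0 r * sphereMean U r := by
  simp_rw [circleAverage_mul_eq_integral]
  rw [integral_const_mul, ← integral_prod_symm _ (integrable_prod_circleMap hk hU)]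
  have h1 : AEStronglyMeasurable (fun p : ℝ × Metric.sphere (0 : Cn m) 1 =>
      k (circleMap 0 r p.1) * U (r • (p.2 : Cn m)))
      ((volume.restrict (Set.Ioc 0 (2 * π))).prod (sphereMeasure m)) := by
    have hk' : Integrable (fun θ => k (circleMap 0 r θ)) (volume.restrict (Set.Ioc 0 (2 * π))) :=
      (intervalIntegrable_iff_integrableOn_Ioc_of_le Real.two_pi_pos.le).1
        (hk.circleIntegrable' : CircleIntegrable k 0 r)
    exact (hk'.mul_prod hU).aestronglyMeasurable
  have hmp := measurePreserving_prod_sphereRot (m := m) (volume.restrict (Set.Ioc 0 (2 * π)))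
  have h2 := integral_map hmp.aemeasurable (by rw [hmp.map_eq]; exact h1)
  rw [hmp.map_eq] at h2
  rw [← h2, integral_prod_mul (fun θ => k (circleMap 0 r θ))
    (fun ξ : Metric.sphere (0 : Cn m) 1 => U (r • (ξ : Cn m))), Real.circleAverage_def,
    intervalIntegral.integral_of_le Real.two_pi_pos.le, smul_eq_mul, sphereMean]
  ring

lemma sphereIntegrable_complex_smul {m : ℕ} {U : Cn m → ℝ} {w : ℂ}
    (hU : SphereIntegrable U ‖w‖) :
    Integrable (fun ξ : Metric.sphere (0 : Cn m) 1 => U (w • (ξ : Cn m))) (sphereMeasure m) := by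
  have h := (measurePreserving_sphereRot (m := m) w.arg).integrable_comp_of_integrable hU
  refine h.congr (ae_of_all _ fun ξ => ?_)
  simp only [Function.comp]
  rw [← circleMap_smul_eq, circleMap, zero_add, Complex.norm_mul_exp_arg_mul_I]

lemma integral_complex_smul {m : ℕ} {U : Cn m → ℝ} {w : ℂ} (hU : SphereIntegrable U ‖w‖) :
    ∫ ξ : Metric.sphere (0 : Cn m) 1, U (w • (ξ : Cn m)) ∂(sphereMeasure m) =
      sphereMean U ‖w‖ := by
  have hmp := measurePreserving_sphereRot (m := m) w.arg
  have h2 := integral_map hmp.aemeasurable (by rw [hmp.map_eq]; exact hU.aestronglyMeasurable)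
  rw [hmp.map_eq] at h2
  rw [sphereMean, h2]
  refine integral_congr_ae (ae_of_all _ fun ξ => ?_)
  simp only
  rw [← circleMap_smul_eq, circleMap, zero_add, Complex.norm_mul_exp_arg_mul_I]

lemma ae_complex_smul {m : ℕ} {P : Cn m → Prop} {w : ℂ}
    (h : ∀ᵐ ξ : Metric.sphere (0 : Cn m) 1 ∂(sphereMeasure m), P (‖w‖ • (ξ : Cn m))) :
    ∀ᵐ ξ : Metric.sphere (0 : Cn m) 1 ∂(sphereMeasure m), P (w • (ξ : Cn m)) := by
  have h := (measurePreserving_sphereRot (m := m) w.arg).quasiMeasurePreserving.ae h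
  filter_upwards [h] with ξ hξ
  rwa [← circleMap_smul_eq, circleMap, zero_add, Complex.norm_mul_exp_arg_mul_I] at hξ

/-! ### Integrability of log|g| over spheres. -/

/-- The function `max (-log ‖x‖) 0`, with value `∞` at the origin. -/
noncomputable def negLogNorm (x : ℂ) : ENNReal :=
  if x = 0 then ⊤ else ENNReal.ofReal (-Real.log ‖x‖)

lemma measurable_negLogNorm : Measurable negLogNorm :=
  Measurable.ite (measurableSet_singleton 0) measurable_const
    (ENNReal.measurable_ofReal.comp (Real.measurable_log.comp measurable_norm).neg)

/-- An upper bound for log⁺|g| and a lower bound for the mean of log|g| together control the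
negative part. -/
lemma lintegral_negLogNorm_le {g : ℂ → ℂ} (hg : AnalyticOnNhd ℂ g Set.univ)
    (hne : ∃ z, g z ≠ 0) {r C L : ℝ} (hr : r ≠ 0)
    (hC : ∀ θ, Real.posLog ‖g (circleMap 0 r θ)‖ ≤ C)
    (hL : L ≤ Real.circleAverage (fun z => Real.log ‖g z‖) 0 r) :
    ∫⁻ θ in Set.Ioc 0 (2 * π), negLogNorm (g (circleMap 0 r θ)) ≤
      ENNReal.ofReal (2 * π * (C - L)) := by
  have hI : Integrable (fun θ => Real.log ‖g (circleMap 0 r θ)‖)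
      (volume.restrict (Set.Ioc 0 (2 * π))) :=
    (intervalIntegrable_iff_integrableOn_Ioc_of_le Real.two_pi_pos.le).1
      (entire_circleIntegrable_log_norm hg r)
  have hle : ∫⁻ θ in Set.Ioc 0 (2 * π), negLogNorm (g (circleMap 0 r θ)) ≤
      ∫⁻ θ in Set.Ioc 0 (2 * π), ENNReal.ofReal (C - Real.log ‖g (circleMap 0 r θ)‖) := by
    refine lintegral_mono_ae (ae_restrict_of_ae ?_)
    filter_upwards [entire_circleMap_ne_zero_ae hg hne hr] with θ hθ
    rw [negLogNorm, if_neg hθ]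
    refine ENNReal.ofReal_le_ofReal ?_
    have := Real.posLog_nonneg.trans (hC θ)
    linarith
  refine hle.trans ?_
  have hIs : Integrable (fun θ => C - Real.log ‖g (circleMap 0 r θ)‖)
      (volume.restrict (Set.Ioc 0 (2 * π))) := (integrable_const C).sub hI
  rw [← ofReal_integral_eq_lintegral_ofReal hIs
    (ae_of_all _ fun θ => sub_nonneg.2 ((log_le_posLog _).trans (hC θ))),
    integral_sub (integrable_const C) hI]
  refine ENNReal.ofReal_le_ofReal ?_
  rw [Real.circleAverage_def, intervalIntegral.integral_of_le Real.two_pi_pos.le, smul_eq_mul,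
    le_inv_mul_iff₀ Real.two_pi_pos] at hL
  simp only [integral_const, smul_eq_mul, measureReal_restrict_apply_univ, Real.volume_real_Ioc,
    sub_zero, max_eq_left Real.two_pi_pos.le]
  linarith

lemma IsEntire.continuous {m : ℕ} {g : Cn m → ℂ} (hg : IsEntire g) : Continuous g :=
  continuousOn_univ.1 hg.continuousOn

/-- Restriction of an entire function to a complex line. -/
lemma IsEntire.line {m : ℕ} {g : Cn m → ℂ} (hg : IsEntire g) (a z : Cn m) :
    AnalyticOnNhd ℂ (fun w : ℂ => g (a + w • z)) Set.univ := by
  refine AnalyticOnNhd.comp (t := Set.univ) hg ?_ (Set.mapsTo_univ _ _)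
  intro w _
  fun_prop

lemma IsEntire.slice {m : ℕ} {g : Cn m → ℂ} (hg : IsEntire g) (z : Cn m) :
    AnalyticOnNhd ℂ (fun w : ℂ => g (w • z)) Set.univ := by
  simpa using hg.line 0 z

lemma circleAverage_poissonKernel_zero_mul (u : ℂ → ℝ) {r : ℝ} (hr : r ≠ 0) :
    Real.circleAverage (fun z => poissonKernel 0 0 z * u z) 0 r = Real.circleAverage u 0 r := by
  refine Real.circleAverage_congr_sphere fun z hz => ?_
  have hz : ‖z‖ ≠ 0 := by
    have : ‖z‖ = |r| := by simpa using hz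
    rw [this]; simpa using hr
  simp [poissonKernel_def, hz]

/-- On each circle centred at `a` in a complex line, the mean of log|g| is at least log|g(a)|.
Averaging the integrand over rotations about `a` therefore bounds it uniformly. -/
lemma lintegral_ball_negLogNorm_add_lt_top {m : ℕ} {g : Cn m → ℂ} (hg : IsEntire g) {a : Cn m}
    (ha : g a ≠ 0) (R : ℝ) :
    ∫⁻ z in Metric.ball (0 : Cn m) R, negLogNorm (g (a + z)) < ⊤ := by
  set μ := (volume : Measure (Cn m)).restrict (Metric.ball 0 R)
  set ν := (volume : Measure ℝ).restrict (Set.Ioc 0 (2 * π))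
  have hF : Measurable fun z => negLogNorm (g (a + z)) :=
    measurable_negLogNorm.comp (hg.continuous.comp (continuous_const.add continuous_id)).measurable
  have hact : Measurable (Function.uncurry fun θ (z : Cn m) => expSMul m θ z) := by
    refine Continuous.measurable ?_
    simp only [Function.uncurry_def, expSMul_apply]
    fun_prop
  have hmp : ∀ θ, MeasurePreserving (expSMul m θ) μ μ := fun θ => by
    have h := (expSMul m θ).measurePreserving.restrict_preimage
      (Metric.isOpen_ball (x := (0 : Cn m)) (ε := R)).measurableSet
    have hb : expSMul m θ ⁻¹' (Metric.ball (0 : Cn m) R) = Metric.ball 0 R := by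
      ext z; simp
    rwa [hb] at h
  have key := lintegral_lintegral_comp_eq (ν := ν) hact hmp hF
  obtain ⟨C, hC0, hC⟩ := exists_log_norm_le_of_continuous hg.continuous (‖a‖ + R)
  have hbound : ∫⁻ z, ∫⁻ θ, negLogNorm (g (a + expSMul m θ z)) ∂ν ∂μ ≤
      ∫⁻ z, ENNReal.ofReal (2 * π * (C - Real.log ‖g a‖)) ∂μ := by
    refine setLIntegral_mono measurable_const fun z hz => ?_
    have hsl := hg.line a z
    have h0 : (fun w : ℂ => g (a + w • z)) 0 ≠ 0 := by simpa using ha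
    have hP := log_norm_le_circleAverage_poissonKernel hsl (w := 0) (R := 1) (by simp) h0
    rw [circleAverage_poissonKernel_zero_mul _ one_ne_zero] at hP
    have := lintegral_negLogNorm_le hsl ⟨0, h0⟩ (r := 1) (C := C) one_ne_zero (fun θ => by
      refine hC _ ((norm_add_le _ _).trans ?_)
      rw [norm_smul, norm_circleMap_zero, abs_one, one_mul]
      have : ‖z‖ < R := by simpa using hz
      linarith) hP
    simpa [circleMap, expSMul_apply] using this
  rw [key, lintegral_const] at hbound
  have hfin : ENNReal.ofReal (2 * π * (C - Real.log ‖g a‖)) * μ Set.univ < ⊤ := by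
    refine ENNReal.mul_lt_top ENNReal.ofReal_lt_top ?_
    simp only [μ, Measure.restrict_apply_univ]
    exact measure_ball_lt_top
  have hν : ν Set.univ ≠ 0 := by
    simp [ν, Real.pi_pos]
  exact (ENNReal.mul_lt_top_iff.1 (hbound.trans_lt hfin)).elim (fun h => h.2)
    (fun h => h.elim (fun h => absurd h hν) (fun h => h ▸ ENNReal.zero_lt_top))

lemma lintegral_ball_negLogNorm_lt_top {m : ℕ} {g : Cn m → ℂ} (hg : IsEntire g)
    (hne : ∃ z, g z ≠ 0) (R : ℝ) :
    ∫⁻ z in Metric.ball (0 : Cn m) R, negLogNorm (g z) < ⊤ := by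
  obtain ⟨a, ha⟩ := hne
  refine lt_of_le_of_lt ?_ (lintegral_ball_negLogNorm_add_lt_top hg ha (R + ‖a‖))
  rw [← lintegral_indicator measurableSet_ball, ← lintegral_indicator measurableSet_ball,
    ← lintegral_add_left_eq_self _ a]
  refine lintegral_mono fun z => ?_
  by_cases hz : a + z ∈ Metric.ball (0 : Cn m) R
  · have hz' : z ∈ Metric.ball (0 : Cn m) (R + ‖a‖) := by
      rw [mem_ball_zero_iff] at hz ⊢
      have := norm_sub_le (a + z) a
      rw [add_sub_cancel_left] at this
      linarith
    rw [Set.indicator_of_mem hz, Set.indicator_of_mem hz']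
  · rw [Set.indicator_of_notMem hz]
    exact zero_le

/-- In polar coordinates, infinite integrals over all spheres of radius below ε would make the
integral over the ball infinite. -/
lemma exists_sphere_lintegral_lt_top {m : ℕ} [NeZero m] {F : Cn m → ENNReal} (hF : Measurable F)
    {ε : ℝ} (hε : 0 < ε) (h : ∫⁻ z in Metric.ball (0 : Cn m) ε, F z < ⊤) :
    ∃ s, 0 < s ∧ s < ε ∧
      ∫⁻ ξ : Metric.sphere (0 : Cn m) 1, F (s • (ξ : Cn m)) ∂(sphereMeasure m) < ⊤ := by
  by_contra! hcon
  refine h.ne ?_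
  set σ := (volume : Measure (Cn m)).toSphere
  have htop : ∀ s, 0 < s → s < ε → ∫⁻ ξ : Metric.sphere (0 : Cn m) 1, F (s • (ξ : Cn m)) ∂σ = ⊤ := by
    intro s hs hsε
    have h1 := top_le_iff.1 (hcon s hs hsε)
    by_contra hlt
    rw [sphereMeasure, lintegral_smul_measure, smul_eq_mul] at h1
    refine (ENNReal.mul_lt_top (ENNReal.inv_lt_top.2 (pos_iff_ne_zero.2 ?_))
      (lt_top_iff_ne_top.2 hlt)).ne h1
    exact Measure.measure_univ_ne_zero.2 (Measure.toSphere_ne_zero _)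
  set n := Module.finrank ℝ (Cn m) - 1
  have hG : Measurable ((Metric.ball (0 : Cn m) ε).indicator F) := hF.indicator measurableSet_ball
  have hmp := (volume : Measure (Cn m)).measurePreserving_homeomorphUnitSphereProd.symm
    (homeomorphUnitSphereProd (Cn m)).toMeasurableEquiv
  have hsymm : ∀ p : Metric.sphere (0 : Cn m) 1 × Set.Ioi (0 : ℝ),
      (((homeomorphUnitSphereProd (Cn m)).symm p : ({0}ᶜ : Set (Cn m))) : Cn m) = p.2.1 • p.1.1 :=
    fun p => rfl
  rw [← lintegral_indicator measurableSet_ball, ← restrict_compl_singleton (μ := volume) (0 : Cn m),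
    ← lintegral_subtype_comap (measurableSet_singleton _).compl]
  have hconv : ∫⁻ p, (Metric.ball (0 : Cn m) ε).indicator F
      (((homeomorphUnitSphereProd (Cn m)).symm p : ({0}ᶜ : Set (Cn m))) : Cn m)
        ∂(σ.prod (Measure.volumeIoiPow n)) = ⊤ := by
    simp_rw [hsymm]
    rw [lintegral_prod_symm _ (by
      refine (hG.comp (Continuous.measurable ?_)).aemeasurable
      fun_prop)]
    rw [eq_top_iff]
    calc (⊤ : ENNReal) = ⊤ * Measure.volumeIoiPow n (Set.Iio ⟨ε, hε⟩) := by
          rw [Measure.volumeIoiPow_apply_Iio, ENNReal.top_mul]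
          simp only [ne_eq, ENNReal.ofReal_eq_zero, not_le]
          positivity
      _ = ∫⁻ s in Set.Iio (⟨ε, hε⟩ : Set.Ioi (0 : ℝ)), ⊤ ∂(Measure.volumeIoiPow n) := by
          rw [setLIntegral_const]
      _ ≤ ∫⁻ s in Set.Iio (⟨ε, hε⟩ : Set.Ioi (0 : ℝ)), ∫⁻ ξ : Metric.sphere (0 : Cn m) 1,
            (Metric.ball (0 : Cn m) ε).indicator F (s.1 • ξ.1) ∂σ ∂(Measure.volumeIoiPow n) := by
          refine le_of_eq (setLIntegral_congr_fun measurableSet_Iio fun s hs => ?_)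
          have hs' : s.1 < ε := hs
          rw [← htop s.1 s.2 hs']
          refine lintegral_congr fun ξ => ?_
          rw [Set.indicator_of_mem]
          have : ‖(ξ : Cn m)‖ = 1 := by simp
          simp only [Metric.mem_ball, dist_zero_right, norm_smul, this, mul_one, Real.norm_eq_abs,
            abs_of_pos (show 0 < s.1 from s.2)]
          exact hs'
      _ ≤ _ := setLIntegral_le_lintegral _ _
  exact (hmp.lintegral_comp (hG.comp measurable_subtype_coe)).symm.trans hconv

/-- Since `negLogNorm` is infinite at 0, finiteness of its integral also gives nonvanishing almost
everywhere. -/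
lemma sphereIntegrable_log_norm_of_lintegral_lt_top {m : ℕ} {g : Cn m → ℂ} (hg : IsEntire g) {r : ℝ}
    (h : ∫⁻ ξ : Metric.sphere (0 : Cn m) 1, negLogNorm (g (r • (ξ : Cn m))) ∂(sphereMeasure m) < ⊤) :
    SphereIntegrable (fun z => Real.log ‖g z‖) r ∧
      ∀ᵐ ξ : Metric.sphere (0 : Cn m) 1 ∂(sphereMeasure m), g (r • (ξ : Cn m)) ≠ 0 := by
  have hcont : Continuous fun ξ : Metric.sphere (0 : Cn m) 1 => g (r • (ξ : Cn m)) :=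
    hg.continuous.comp (by fun_prop)
  have hm : Measurable fun ξ : Metric.sphere (0 : Cn m) 1 => negLogNorm (g (r • (ξ : Cn m))) :=
    measurable_negLogNorm.comp hcont.measurable
  have hae : ∀ᵐ ξ : Metric.sphere (0 : Cn m) 1 ∂(sphereMeasure m), g (r • (ξ : Cn m)) ≠ 0 := by
    filter_upwards [ae_lt_top hm h.ne] with ξ hξ h0
    simp [negLogNorm, h0] at hξ
  refine ⟨?_, hae⟩
  obtain ⟨C, hC0, hC⟩ := exists_log_norm_le_of_continuous hg.continuous |r|
  have hI := (integrable_const C).add (integrable_toReal_of_lintegral_ne_top hm.aemeasurable h.ne)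
  refine hI.mono' (Real.measurable_log.comp hcont.norm.measurable).aestronglyMeasurable ?_
  filter_upwards [hae] with ξ hξ
  simp only [Pi.add_apply, negLogNorm, if_neg hξ, ENNReal.toReal_ofReal', Real.norm_eq_abs]
  have h1 := hC (r • (ξ : Cn m)) (by simp [norm_smul])
  have h2 := log_le_posLog ‖g (r • (ξ : Cn m))‖
  rw [abs_le]
  constructor
  · linarith [le_max_left (-Real.log ‖g (r • (ξ : Cn m))‖) 0]
  · linarith [le_max_right (-Real.log ‖g (r • (ξ : Cn m))‖) 0]

/-- For an entire function `g ≢ 0`, `log ‖g‖` is integrable over every sphere. -/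
lemma IsEntire.sphereIntegrable_log_norm_and_ae_ne_zero {m : ℕ} [NeZero m] {g : Cn m → ℂ}
    (hg : IsEntire g) (hne : ∃ z, g z ≠ 0) {r : ℝ} (hr : 0 < r) :
    SphereIntegrable (fun z => Real.log ‖g z‖) r ∧
      ∀ᵐ ξ : Metric.sphere (0 : Cn m) 1 ∂(sphereMeasure m), g (r • (ξ : Cn m)) ≠ 0 := by
  obtain ⟨s, hs, hsr, hslt⟩ := exists_sphere_lintegral_lt_top
    (measurable_negLogNorm.comp hg.continuous.measurable) hr
    (lintegral_ball_negLogNorm_lt_top hg hne r)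
  obtain ⟨hsI, hsne⟩ := sphereIntegrable_log_norm_of_lintegral_lt_top hg hslt
  refine sphereIntegrable_log_norm_of_lintegral_lt_top hg ?_
  have hcont : Continuous fun ξ : Metric.sphere (0 : Cn m) 1 => g (r • (ξ : Cn m)) :=
    hg.continuous.comp (by fun_prop)
  set ν := (volume : Measure ℝ).restrict (Set.Ioc 0 (2 * π))
  have key := lintegral_lintegral_comp_eq (ν := ν) (μ := sphereMeasure m)
    (a := sphereRot) continuous_sphereRot.measurable measurePreserving_sphereRot
    (measurable_negLogNorm.comp hcont.measurable)
  obtain ⟨C, hC0, hC⟩ := exists_log_norm_le_of_continuous hg.continuous r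
  -- Circle means increase with the radius, so the integrable means at radius s < r bound those at r
  -- from below. This carries integrability from one small sphere to the given one.
  set M : Metric.sphere (0 : Cn m) 1 → ℝ := fun ξ =>
    Real.circleAverage (fun w => Real.log ‖g (w • (ξ : Cn m))‖) 0 s
  have hM : Integrable M (sphereMeasure m) := by
    simpa using integrable_circleAverage_mul (k := fun _ => 1) continuousOn_const hsI
  have hbound : ∫⁻ ξ : Metric.sphere (0 : Cn m) 1,
      ∫⁻ θ, negLogNorm (g (r • (sphereRot θ ξ : Cn m))) ∂ν ∂(sphereMeasure m) ≤
      ∫⁻ ξ, ENNReal.ofReal (2 * π * (C - M ξ)) ∂(sphereMeasure m) := by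
    refine lintegral_mono_ae ?_
    filter_upwards [hsne] with ξ hξ
    have hsl := hg.slice (ξ : Cn m)
    have hne' : ∃ w : ℂ, g (w • (ξ : Cn m)) ≠ 0 := ⟨(s : ℂ), by rwa [Complex.coe_smul]⟩
    have := lintegral_negLogNorm_le hsl hne' (r := r) (C := C) hr.ne' (fun θ => by
      refine hC _ ?_
      simp [norm_smul, abs_of_pos hr]) (circleAverage_log_norm_mono hsl hne' hs hsr.le)
    simpa only [circleMap_smul_eq] using this
  simp only [Function.comp] at key
  rw [key] at hbound
  have hfin : ∫⁻ ξ, ENNReal.ofReal (2 * π * (C - M ξ)) ∂(sphereMeasure m) < ⊤ :=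
    (((integrable_const C).sub hM).const_mul (2 * π)).lintegral_lt_top
  have hν : ν Set.univ ≠ 0 := by
    simp [ν, Real.pi_pos]
  exact (ENNReal.mul_lt_top_iff.1 (hbound.trans_lt hfin)).elim (fun h => h.2)
    (fun h => h.elim (fun h => absurd h hν) (fun h => h ▸ ENNReal.zero_lt_top))

/-! ### Poisson estimates for quotients and for pairs. -/

lemma circleAverage_poissonKernel_sub_le {u : ℂ → ℝ} {a b : ℂ} {R : ℝ} (hR : 0 < R)
    (ha : 2 * ‖a‖ ≤ R) (hb : 2 * ‖b‖ ≤ R) (hu : CircleIntegrable u 0 R) :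
    Real.circleAverage (fun z => poissonKernel 0 b z * u z) 0 R
      - Real.circleAverage (fun z => poissonKernel 0 a z * u z) 0 R ≤
    4 * (‖a‖ + ‖b‖) / R * Real.circleAverage (fun z => |u z|) 0 R := by
  have ha' : ‖a‖ < R := by linarith [norm_nonneg a]
  have hb' : ‖b‖ < R := by linarith [norm_nonneg b]
  have hIa := circleIntegrable_poissonKernel_mul ha' hu
  have hIb := circleIntegrable_poissonKernel_mul hb' hu
  have hIabs : CircleIntegrable (fun z => |u z|) 0 R := hu.abs
  rw [← Real.circleAverage_fun_sub hIb hIa, ← smul_eq_mul, ← Real.circleAverage_fun_smul]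
  refine Real.circleAverage_mono (hIb.sub hIa) (hIabs.const_mul _) fun z hz => ?_
  have hz : ‖z‖ = R := by simpa [abs_of_pos hR] using hz
  have h1 := abs_poissonKernel_sub_one_le ha hR hz
  have h2 := abs_poissonKernel_sub_one_le hb hR hz
  have h3 : |poissonKernel 0 b z - poissonKernel 0 a z| ≤ 4 * (‖a‖ + ‖b‖) / R := by
    have := abs_sub_le (poissonKernel 0 b z) 1 (poissonKernel 0 a z)
    rw [abs_sub_comm 1] at this
    refine (this.trans (add_le_add h2 h1)).trans (le_of_eq (by ring))
  simp only [smul_eq_mul]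
  rw [← sub_mul]
  refine (le_abs_self _).trans ?_
  rw [abs_mul]
  gcongr

/-- With u = log|φ₀| − log|φ₁|, one has P_b log|φ₀| + P_a log|φ₁| = (P_b u − P_a u) + P_a log|φ₀| +
P_b log|φ₁|. The exchange puts the kernel at `a` on φ₀ and at `b` on φ₁, to match the denominator
terms log|φ₀(a)| and log|φ₁(b)| subtracted later. -/
lemma log_norm_quotient_le {φ₀ φ₁ : ℂ → ℂ} (h₀ : AnalyticOnNhd ℂ φ₀ Set.univ)
    (h₁ : AnalyticOnNhd ℂ φ₁ Set.univ) {a b : ℂ} {R : ℝ} (hR : 0 < R)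
    (ha : 2 * ‖a‖ ≤ R) (hb : 2 * ‖b‖ ≤ R) (hb₀ : φ₀ b ≠ 0) (ha₁ : φ₁ a ≠ 0) :
    Real.log ‖φ₀ b‖ + Real.log ‖φ₁ a‖ ≤
      4 * (‖a‖ + ‖b‖) / R * Real.circleAverage (fun z => |Real.log ‖φ₀ z‖ - Real.log ‖φ₁ z‖|) 0 R
      + Real.circleAverage (fun z => poissonKernel 0 a z * Real.log ‖φ₀ z‖) 0 R
      + Real.circleAverage (fun z => poissonKernel 0 b z * Real.log ‖φ₁ z‖) 0 R := by
  have ha' : ‖a‖ < R := by linarith [norm_nonneg a]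
  have hb' : ‖b‖ < R := by linarith [norm_nonneg b]
  have hI₀ := entire_circleIntegrable_log_norm h₀ R
  have hI₁ := entire_circleIntegrable_log_norm h₁ R
  have e1 := log_norm_le_circleAverage_poissonKernel h₀ hb' hb₀
  have e2 := log_norm_le_circleAverage_poissonKernel h₁ ha' ha₁
  have e3 := circleAverage_poissonKernel_sub_le hR ha hb (hI₀.sub hI₁)
  have e4 : ∀ c : ℂ, ‖c‖ < R →
      Real.circleAverage (fun z => poissonKernel 0 c z * (Real.log ‖φ₀ z‖ - Real.log ‖φ₁ z‖)) 0 R =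
      Real.circleAverage (fun z => poissonKernel 0 c z * Real.log ‖φ₀ z‖) 0 R
      - Real.circleAverage (fun z => poissonKernel 0 c z * Real.log ‖φ₁ z‖) 0 R := by
    intro c hc
    rw [← Real.circleAverage_fun_sub (circleIntegrable_poissonKernel_mul hc hI₀)
      (circleIntegrable_poissonKernel_mul hc hI₁)]
    simp_rw [mul_sub]
  simp only [Pi.sub_apply] at e3
  rw [e4 a ha', e4 b hb'] at e3
  linarith

lemma log_norm_le_log_sqrt_left {a : ℂ} (b : ℂ) (ha : a ≠ 0) :
    Real.log ‖a‖ ≤ Real.log (√(‖a‖ ^ 2 + ‖b‖ ^ 2)) :=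
  Real.log_le_log (norm_pos_iff.2 ha) (Real.le_sqrt_of_sq_le (by nlinarith [sq_nonneg ‖b‖]))

lemma log_norm_le_log_sqrt_right (a : ℂ) {b : ℂ} (hb : b ≠ 0) :
    Real.log ‖b‖ ≤ Real.log (√(‖a‖ ^ 2 + ‖b‖ ^ 2)) :=
  Real.log_le_log (norm_pos_iff.2 hb) (Real.le_sqrt_of_sq_le (by nlinarith [sq_nonneg ‖a‖]))

lemma log_sqrt_le_add {a b : ℂ} {C₀ C₁ : ℝ} (h₀ : Real.posLog ‖a‖ ≤ C₀) (h₁ : Real.posLog ‖b‖ ≤ C₁) :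
    Real.log (√(‖a‖ ^ 2 + ‖b‖ ^ 2)) ≤ Real.log 2 + C₀ + C₁ := by
  have h2 : √(‖a‖ ^ 2 + ‖b‖ ^ 2) ≤ ‖a‖ + ‖b‖ := by
    rw [Real.sqrt_le_left (by positivity)]
    nlinarith [norm_nonneg a, norm_nonneg b, mul_nonneg (norm_nonneg a) (norm_nonneg b)]
  have h3 := Real.posLog_le_posLog (Real.sqrt_nonneg _) h2
  have h4 := Real.posLog_add (x := ‖a‖) (y := ‖b‖)
  linarith [log_le_posLog (√(‖a‖ ^ 2 + ‖b‖ ^ 2))]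

/-- Poisson's inequality for the logarithm of the norm of a pair of entire functions. -/
lemma log_sqrt_le_circleAverage_poissonKernel {φ₀ φ₁ : ℂ → ℂ} (h₀ : AnalyticOnNhd ℂ φ₀ Set.univ)
    (h₁ : AnalyticOnNhd ℂ φ₁ Set.univ) {w : ℂ} {R : ℝ} (hw : ‖w‖ < R) (hw₁ : φ₁ w ≠ 0) :
    Real.log (√(‖φ₀ w‖ ^ 2 + ‖φ₁ w‖ ^ 2)) ≤ Real.circleAverage (fun z => poissonKernel 0 w z *
      Real.log (√(‖φ₀ z‖ ^ 2 + ‖φ₁ z‖ ^ 2))) 0 R := by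
  have hR : 0 < R := (norm_nonneg w).trans_lt hw
  set n := √(‖φ₀ w‖ ^ 2 + ‖φ₁ w‖ ^ 2)
  have hn2 : n ^ 2 = ‖φ₀ w‖ ^ 2 + ‖φ₁ w‖ ^ 2 := Real.sq_sqrt (by positivity)
  have hn : 0 < n := Real.sqrt_pos.2 (by have := norm_pos_iff.2 hw₁; positivity)
  have hnc : (n : ℂ) ≠ 0 := by exact_mod_cast hn.ne'
  -- Pairing with the unit vector in the direction of (φ₀(w), φ₁(w)) gives an entire function,
  -- bounded by the norm of the pair by Cauchy–Schwarz, with equality at `w`.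
  set φ : ℂ → ℂ := fun z =>
    (starRingEnd ℂ (φ₀ w) * φ₀ z + starRingEnd ℂ (φ₁ w) * φ₁ z) / n with hφ
  have hφa : AnalyticOnNhd ℂ φ Set.univ := fun z hz => by
    have := h₀ z hz
    have := h₁ z hz
    fun_prop (disch := assumption)
  have hφw : φ w = n := by
    rw [hφ]
    simp only
    rw [div_eq_iff hnc, ← Complex.normSq_eq_conj_mul_self, ← Complex.normSq_eq_conj_mul_self,
      Complex.normSq_eq_norm_sq, Complex.normSq_eq_norm_sq]
    rw [← pow_two]
    exact_mod_cast hn2.symm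
  have hP := log_norm_le_circleAverage_poissonKernel hφa hw (by rw [hφw]; exact hnc)
  have hnorm : Real.log ‖φ w‖ = Real.log n := by
    rw [hφw, Complex.norm_real, Real.norm_eq_abs, abs_of_pos hn]
  rw [hnorm] at hP
  refine hP.trans ?_
  have hbd : ∀ z, ‖φ z‖ ≤ √(‖φ₀ z‖ ^ 2 + ‖φ₁ z‖ ^ 2) := by
    intro z
    rw [hφ]
    simp only
    rw [norm_div, Complex.norm_real, Real.norm_eq_abs, abs_of_pos hn, div_le_iff₀ hn, mul_comm]
    refine (norm_add_le _ _).trans ?_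
    rw [norm_mul, norm_mul, RCLike.norm_conj, RCLike.norm_conj, ← Real.sqrt_mul (by positivity)]
    refine Real.le_sqrt_of_sq_le ?_
    nlinarith [sq_nonneg (‖φ₀ w‖ * ‖φ₁ z‖ - ‖φ₁ w‖ * ‖φ₀ z‖)]
  have hI := entire_circleIntegrable_log_norm hφa R
  have hIu : CircleIntegrable (fun z => Real.log (√(‖φ₀ z‖ ^ 2 + ‖φ₁ z‖ ^ 2))) 0 R := by
    obtain ⟨C₀, hC₀, hC₀'⟩ := exists_log_norm_le_of_continuous (continuousOn_univ.1 h₀.continuousOn) R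
    obtain ⟨C₁, hC₁, hC₁'⟩ := exists_log_norm_le_of_continuous (continuousOn_univ.1 h₁.continuousOn) R
    have hI1 := (entire_circleIntegrable_log_norm h₁ R).abs.add
      (circleIntegrable_const (Real.log 2 + C₀ + C₁) 0 R)
    refine IntervalIntegrable.mono_fun' hI1 ?_ ?_
    · refine Measurable.aestronglyMeasurable (Real.measurable_log.comp (Continuous.measurable ?_))
      have c0 := (continuousOn_univ.1 h₀.continuousOn)
      have c1 := (continuousOn_univ.1 h₁.continuousOn)
      fun_prop
    · refine ae_restrict_of_ae ?_
      filter_upwards [entire_circleMap_ne_zero_ae h₁ ⟨w, hw₁⟩ hR.ne'] with θ hθ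
      have hm : ‖circleMap 0 R θ‖ ≤ R := by simp [abs_of_pos hR]
      have e1 := log_norm_le_log_sqrt_right (φ₀ (circleMap 0 R θ)) hθ
      have e2 := log_sqrt_le_add (hC₀' _ hm) (hC₁' _ hm)
      have e3 := neg_abs_le (Real.log ‖φ₁ (circleMap 0 R θ)‖)
      have e4 := abs_nonneg (Real.log ‖φ₁ (circleMap 0 R θ)‖)
      have e5 := Real.log_pos one_lt_two
      rw [Real.norm_eq_abs, abs_le]
      simp only [Pi.add_apply, Pi.abs_apply]
      constructor <;> linarith
  refine circleAverage_mono_ae (circleIntegrable_poissonKernel_mul hw hI)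
    (circleIntegrable_poissonKernel_mul hw hIu) ?_
  filter_upwards [entire_circleMap_ne_zero_ae hφa ⟨w, by rw [hφw]; exact hnc⟩ hR.ne'] with θ hθ
  refine mul_le_mul_of_nonneg_left (Real.log_le_log (norm_pos_iff.2 hθ) (hbd _))
    (poissonKernel_nonneg hw (by simp [abs_of_pos hR]))

/-! ### Spherical means on ℂ^m. -/

lemma sphereMean_eq_integral_circleAverage {m : ℕ} {U : Cn m → ℝ} {r : ℝ} (hU : SphereIntegrable U r) :
    sphereMean U r = ∫ ξ : Metric.sphere (0 : Cn m) 1,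
      Real.circleAverage (fun w => U (w • (ξ : Cn m))) 0 r ∂(sphereMeasure m) := by
  have := integral_circleAverage_mul (k := fun _ => 1) continuousOn_const hU
  simpa [Real.circleAverage_const] using this.symm

lemma integrable_circleAverage {m : ℕ} {U : Cn m → ℝ} {r : ℝ} (hU : SphereIntegrable U r) :
    Integrable (fun ξ : Metric.sphere (0 : Cn m) 1 =>
      Real.circleAverage (fun w => U (w • (ξ : Cn m))) 0 r) (sphereMeasure m) := by
  simpa using integrable_circleAverage_mul (k := fun _ => 1) continuousOn_const hU


lemma integral_le_integral_of_ae_le {X : Type*} [MeasurableSpace X] {μ : Measure X} {u v : X → ℝ}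
    (hu : Integrable u μ) (hv : Integrable v μ) (h : ∀ᵐ x ∂μ, u x ≤ v x) :
    ∫ x, u x ∂μ ≤ ∫ x, v x ∂μ :=
  integral_mono_ae hu hv h

section Means

variable {m : ℕ} [NeZero m] {f₀ f₁ : Cn m → ℂ}

/-- Spherical means of `log ‖g‖` are convex functions of `log r`. -/
lemma convexOn_sphereMean_log_norm (h₀ : IsEntire f₀) (n₀ : ∃ z, f₀ z ≠ 0) :
    ConvexOn ℝ Set.univ (fun t : ℝ => sphereMean (fun z => Real.log ‖f₀ z‖) (Real.exp t)) := by
  have hI := fun t : ℝ => (h₀.sphereIntegrable_log_norm_and_ae_ne_zero n₀ (Real.exp_pos t)).1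
  refine ⟨convex_univ, fun x _ y _ a b ha hb hab => ?_⟩
  simp only [smul_eq_mul]
  rw [sphereMean_eq_integral_circleAverage (hI _), sphereMean_eq_integral_circleAverage (hI x),
    sphereMean_eq_integral_circleAverage (hI y), ← integral_const_mul, ← integral_const_mul,
    ← integral_add ((integrable_circleAverage (hI x)).const_mul a)
      ((integrable_circleAverage (hI y)).const_mul b)]
  have e1 := integrable_circleAverage (hI (a * x + b * y))
  have e2 := integrable_circleAverage (hI x)
  have e3 := integrable_circleAverage (hI y)
  refine integral_le_integral_of_ae_le e1 ((e2.const_mul a).add (e3.const_mul b)) ?_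
  filter_upwards [(h₀.sphereIntegrable_log_norm_and_ae_ne_zero n₀ (Real.exp_pos x)).2] with ξ hξ
  have hne : ∃ w : ℂ, f₀ (w • (ξ : Cn m)) ≠ 0 := ⟨(Real.exp x : ℝ), by rwa [Complex.coe_smul]⟩
  exact (convexOn_circleAverage_log_norm (h₀.slice ξ) hne).2
    (Set.mem_univ x) (Set.mem_univ y) ha hb hab

lemma sphereIntegrable_log_sqrt (h₀ : IsEntire f₀) (h₁ : IsEntire f₁) (n₁ : ∃ z, f₁ z ≠ 0)
    {r : ℝ} (hr : 0 < r) :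
    SphereIntegrable (fun z => Real.log (√(‖f₀ z‖ ^ 2 + ‖f₁ z‖ ^ 2))) r := by
  obtain ⟨hI, hne⟩ := h₁.sphereIntegrable_log_norm_and_ae_ne_zero n₁ hr
  obtain ⟨C₀, hC₀, hC₀'⟩ := exists_log_norm_le_of_continuous h₀.continuous r
  obtain ⟨C₁, hC₁, hC₁'⟩ := exists_log_norm_le_of_continuous h₁.continuous r
  refine (hI.abs.add (integrable_const (Real.log 2 + C₀ + C₁))).mono' ?_ ?_
  · refine Measurable.aestronglyMeasurable (Real.measurable_log.comp (Continuous.measurable ?_))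
    have c0 := h₀.continuous
    have c1 := h₁.continuous
    fun_prop
  · filter_upwards [hne] with ξ hξ
    have hm : ‖r • (ξ : Cn m)‖ ≤ r := by simp [norm_smul, abs_of_pos hr]
    have e1 := log_norm_le_log_sqrt_right (f₀ (r • (ξ : Cn m))) hξ
    have e2 := log_sqrt_le_add (hC₀' _ hm) (hC₁' _ hm)
    have e3 := neg_abs_le (Real.log ‖f₁ (r • (ξ : Cn m))‖)
    have e4 := abs_nonneg (Real.log ‖f₁ (r • (ξ : Cn m))‖)
    have e5 := Real.log_pos one_lt_two
    rw [Real.norm_eq_abs, abs_le]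
    simp only [Pi.add_apply]
    constructor <;> linarith

lemma sphereMean_log_norm_le_left (h₀ : IsEntire f₀) (h₁ : IsEntire f₁) (n₀ : ∃ z, f₀ z ≠ 0)
    (n₁ : ∃ z, f₁ z ≠ 0) {r : ℝ} (hr : 0 < r) :
    sphereMean (fun z => Real.log ‖f₀ z‖) r ≤
      sphereMean (fun z => Real.log (√(‖f₀ z‖ ^ 2 + ‖f₁ z‖ ^ 2))) r := by
  obtain ⟨hI, hne⟩ := h₀.sphereIntegrable_log_norm_and_ae_ne_zero n₀ hr
  exact integral_le_integral_of_ae_le hI (sphereIntegrable_log_sqrt h₀ h₁ n₁ hr)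
    (hne.mono fun ξ hξ => log_norm_le_log_sqrt_left _ hξ)

lemma sphereMean_log_norm_le_right (h₀ : IsEntire f₀) (h₁ : IsEntire f₁)
    (n₁ : ∃ z, f₁ z ≠ 0) {r : ℝ} (hr : 0 < r) :
    sphereMean (fun z => Real.log ‖f₁ z‖) r ≤
      sphereMean (fun z => Real.log (√(‖f₀ z‖ ^ 2 + ‖f₁ z‖ ^ 2))) r := by
  obtain ⟨hI, hne⟩ := h₁.sphereIntegrable_log_norm_and_ae_ne_zero n₁ hr
  exact integral_le_integral_of_ae_le hI (sphereIntegrable_log_sqrt h₀ h₁ n₁ hr)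
    (hne.mono fun ξ hξ => log_norm_le_log_sqrt_right _ hξ)

/-- Poisson's inequality for the pair, at the point r of the disc of radius s, is integrated over
all lines; the kernel has mean one. -/
lemma sphereMean_log_sqrt_mono (h₀ : IsEntire f₀) (h₁ : IsEntire f₁) (n₁ : ∃ z, f₁ z ≠ 0)
    {r s : ℝ} (hr : 0 < r) (hrs : r ≤ s) :
    sphereMean (fun z => Real.log (√(‖f₀ z‖ ^ 2 + ‖f₁ z‖ ^ 2))) r ≤
      sphereMean (fun z => Real.log (√(‖f₀ z‖ ^ 2 + ‖f₁ z‖ ^ 2))) s := by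
  rcases hrs.eq_or_lt with rfl | hrs
  · rfl
  have hnr : ‖(r : ℂ)‖ = r := by rw [Complex.norm_real, Real.norm_eq_abs, abs_of_pos hr]
  have hns : ‖(r : ℂ)‖ < s := by rwa [hnr]
  have hK := continuousOn_poissonKernel hns
  have hI := sphereIntegrable_log_sqrt h₀ h₁ n₁ (hr.trans hrs)
  have h1 := integral_circleAverage_mul hK hI
  rw [circleAverage_poissonKernel hns, one_mul] at h1
  rw [← h1]
  have e1 := sphereIntegrable_log_sqrt h₀ h₁ n₁ hr
  have e2 := integrable_circleAverage_mul hK hI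
  refine integral_le_integral_of_ae_le e1 e2 ?_
  filter_upwards [(h₁.sphereIntegrable_log_norm_and_ae_ne_zero n₁ hr).2] with ξ hξ
  rw [← Complex.coe_smul] at hξ
  have := log_sqrt_le_circleAverage_poissonKernel (h₀.slice ξ) (h₁.slice ξ) hns hξ
  simpa only [Complex.coe_smul] using this

lemma sphereMean_log_norm_mono (h₀ : IsEntire f₀) (n₀ : ∃ z, f₀ z ≠ 0)
    {r s : ℝ} (hr : 0 < r) (hrs : r ≤ s) :
    sphereMean (fun z => Real.log ‖f₀ z‖) r ≤ sphereMean (fun z => Real.log ‖f₀ z‖) s := by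
  have hIr := (h₀.sphereIntegrable_log_norm_and_ae_ne_zero n₀ hr).1
  have hIs := (h₀.sphereIntegrable_log_norm_and_ae_ne_zero n₀ (hr.trans_le hrs)).1
  rw [sphereMean_eq_integral_circleAverage hIr, sphereMean_eq_integral_circleAverage hIs]
  have e1 := integrable_circleAverage hIr
  have e2 := integrable_circleAverage hIs
  refine integral_le_integral_of_ae_le e1 e2 ?_
  filter_upwards [(h₀.sphereIntegrable_log_norm_and_ae_ne_zero n₀ hr).2] with ξ hξ
  have hne : ∃ w : ℂ, f₀ (w • (ξ : Cn m)) ≠ 0 := ⟨r, by rwa [Complex.coe_smul]⟩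
  exact circleAverage_log_norm_mono (h₀.slice ξ) hne hr hrs

/-- Uses |x − y| = 2 max(x, y) − x − y, where the maximum is at most log‖(f₀,f₁)‖. -/
lemma sphereMean_abs_log_sub_le (h₀ : IsEntire f₀) (h₁ : IsEntire f₁) (n₀ : ∃ z, f₀ z ≠ 0)
    (n₁ : ∃ z, f₁ z ≠ 0) {r : ℝ} (hr : 0 < r) :
    sphereMean (fun z => |Real.log ‖f₀ z‖ - Real.log ‖f₁ z‖|) r ≤
      2 * sphereMean (fun z => Real.log (√(‖f₀ z‖ ^ 2 + ‖f₁ z‖ ^ 2))) r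
      - sphereMean (fun z => Real.log ‖f₀ z‖) r - sphereMean (fun z => Real.log ‖f₁ z‖) r := by
  obtain ⟨hI₀, hn₀⟩ := h₀.sphereIntegrable_log_norm_and_ae_ne_zero n₀ hr
  obtain ⟨hI₁, hn₁⟩ := h₁.sphereIntegrable_log_norm_and_ae_ne_zero n₁ hr
  have hI := sphereIntegrable_log_sqrt h₀ h₁ n₁ hr
  unfold sphereMean
  rw [← integral_const_mul, ← integral_sub (hI.const_mul 2) hI₀,
    ← integral_sub (by exact (hI.const_mul 2).sub hI₀) hI₁]
  refine integral_le_integral_of_ae_le (hI₀.sub hI₁).abs (((hI.const_mul 2).sub hI₀).sub hI₁) ?_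
  filter_upwards [hn₀, hn₁] with ξ hξ₀ hξ₁
  have e0 := log_norm_le_log_sqrt_left (f₁ (r • (ξ : Cn m))) hξ₀
  have e1 := log_norm_le_log_sqrt_right (f₀ (r • (ξ : Cn m))) hξ₁
  rw [abs_le]
  constructor <;> linarith

/-! ### The proximity estimate. -/

lemma posLog_norm_div_div_le {a₀ a₁ b₀ b₁ : ℂ} (ha₀ : a₀ ≠ 0) (ha₁ : a₁ ≠ 0) (hb₀ : b₀ ≠ 0)
    (hb₁ : b₁ ≠ 0) : Real.posLog ‖b₀ / b₁ / (a₀ / a₁)‖ =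
      max 0 (Real.log ‖b₀‖ + Real.log ‖a₁‖ - Real.log ‖a₀‖ - Real.log ‖b₁‖) := by
  have h := fun {x : ℂ} (hx : x ≠ 0) => norm_ne_zero_iff.2 hx
  rw [Real.posLog_apply, norm_div, norm_div, norm_div, Real.log_div (div_ne_zero (h hb₀) (h hb₁))
    (div_ne_zero (h ha₀) (h ha₁)), Real.log_div (h hb₀) (h hb₁), Real.log_div (h ha₀) (h ha₁)]
  congr 1
  ring

/-- The basic estimate of the proximity function of `f(qz) / f(z)` in terms of spherical means. -/
lemma proximity_scaling_le {f : Cn m → ℂ} (h₀ : IsEntire f₀) (h₁ : IsEntire f₁)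
    (n₀ : ∃ z, f₀ z ≠ 0) (n₁ : ∃ z, f₁ z ≠ 0) (hf : ∀ z, f₁ z ≠ 0 → f z = f₀ z / f₁ z)
    {q : ℂ} (hq : q ≠ 0) {r R : ℝ} (hr : 0 < r) (hrR : 2 * r ≤ R) (hqR : 2 * (‖q‖ * r) ≤ R) :
    SphereIntegrable (fun z => Real.posLog ‖f (q • z) / f z‖) r ∧
    proximity (fun z => f (q • z) / f z) r ≤
      4 * (r + ‖q‖ * r) / R *
        (2 * sphereMean (fun z => Real.log (√(‖f₀ z‖ ^ 2 + ‖f₁ z‖ ^ 2))) R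
        - sphereMean (fun z => Real.log ‖f₀ z‖) R - sphereMean (fun z => Real.log ‖f₁ z‖) R)
      + (sphereMean (fun z => Real.log ‖f₀ z‖) R - sphereMean (fun z => Real.log ‖f₀ z‖) r)
      + (sphereMean (fun z => Real.log ‖f₁ z‖) R
        - sphereMean (fun z => Real.log ‖f₁ z‖) (‖q‖ * r)) := by
  have hR : 0 < R := by linarith
  have hqr : 0 < ‖q‖ * r := mul_pos (norm_pos_iff.2 hq) hr
  have hna : ‖(r : ℂ)‖ = r := by rw [Complex.norm_real, Real.norm_eq_abs, abs_of_pos hr]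
  have hnb : ‖q * (r : ℂ)‖ = ‖q‖ * r := by rw [norm_mul, hna]
  have ha : 2 * ‖(r : ℂ)‖ ≤ R := by rwa [hna]
  have hb : 2 * ‖q * (r : ℂ)‖ ≤ R := by rwa [hnb]
  have ha' : ‖(r : ℂ)‖ < R := by rw [hna]; linarith
  have hb' : ‖q * (r : ℂ)‖ < R := by rw [hnb]; linarith
  obtain ⟨hI₀, hn₀⟩ := h₀.sphereIntegrable_log_norm_and_ae_ne_zero n₀ hr
  obtain ⟨hI₁, hn₁⟩ := h₁.sphereIntegrable_log_norm_and_ae_ne_zero n₁ hr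
  obtain ⟨hJ₀, hm₀⟩ := h₀.sphereIntegrable_log_norm_and_ae_ne_zero n₀ hqr
  obtain ⟨hJ₁, hm₁⟩ := h₁.sphereIntegrable_log_norm_and_ae_ne_zero n₁ hqr
  rw [← hnb] at hJ₀ hm₀ hJ₁ hm₁
  obtain ⟨hR₀, -⟩ := h₀.sphereIntegrable_log_norm_and_ae_ne_zero n₀ hR
  obtain ⟨hR₁, -⟩ := h₁.sphereIntegrable_log_norm_and_ae_ne_zero n₁ hR
  have hm₀ := ae_complex_smul (P := fun z => f₀ z ≠ 0) hm₀
  have hm₁ := ae_complex_smul (P := fun z => f₁ z ≠ 0) hm₁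
  have hUabs : SphereIntegrable (fun z => |Real.log ‖f₀ z‖ - Real.log ‖f₁ z‖|) R := (hR₀.sub hR₁).abs
  have hJ₀' := sphereIntegrable_complex_smul hJ₀
  have hJ₁' := sphereIntegrable_complex_smul hJ₁
  have hval : ∀ᵐ ξ : Metric.sphere (0 : Cn m) 1 ∂(sphereMeasure m),
      Real.posLog ‖f (q • r • (ξ : Cn m)) / f (r • (ξ : Cn m))‖ =
      max 0 (Real.log ‖f₀ ((q * r) • (ξ : Cn m))‖ + Real.log ‖f₁ (r • (ξ : Cn m))‖
        - Real.log ‖f₀ (r • (ξ : Cn m))‖ - Real.log ‖f₁ ((q * r) • (ξ : Cn m))‖) := by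
    filter_upwards [hn₀, hn₁, hm₀, hm₁] with ξ e1 e2 e3 e4
    have : q • r • (ξ : Cn m) = (q * r) • (ξ : Cn m) := by rw [mul_smul, Complex.coe_smul]
    rw [this, hf _ e2, hf _ e4]
    exact posLog_norm_div_div_le e1 e2 e3 e4
  have hint : SphereIntegrable (fun z => Real.posLog ‖f (q • z) / f z‖) r := by
    refine Integrable.congr ?_ (hval.mono fun _ h => h.symm)
    have := ((hJ₀'.add hI₁).sub hI₀).sub hJ₁'
    exact this.pos_part.congr (ae_of_all _ fun ξ => max_comm _ _)
  refine ⟨hint, ?_⟩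
  have hKa := continuousOn_poissonKernel ha'
  have hKb := continuousOn_poissonKernel hb'
  have i1 := (integrable_circleAverage hUabs).const_mul (4 * (r + ‖q‖ * r) / R)
  have i2 := (integrable_circleAverage_mul hKa hR₀).sub hI₀
  have i3 := (integrable_circleAverage_mul hKb hR₁).sub hJ₁'
  have hle : proximity (fun z => f (q • z) / f z) r ≤ _ :=
    integral_le_integral_of_ae_le hint ((i1.add i2).add i3) ?_
  · rw [integral_add' (i1.add i2) i3, integral_add' i1 i2, integral_const_mul,
      integral_sub' (integrable_circleAverage_mul hKa hR₀) hI₀,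
      integral_sub' (integrable_circleAverage_mul hKb hR₁) hJ₁',
      integral_circleAverage_mul hKa hR₀, integral_circleAverage_mul hKb hR₁,
      circleAverage_poissonKernel ha', circleAverage_poissonKernel hb', integral_complex_smul hJ₁,
      ← sphereMean_eq_integral_circleAverage hUabs, one_mul, one_mul, hnb] at hle
    refine hle.trans ?_
    have := mul_le_mul_of_nonneg_left (sphereMean_abs_log_sub_le h₀ h₁ n₀ n₁ hR)
      (show 0 ≤ 4 * (r + ‖q‖ * r) / R by positivity)
    simp only [sphereMean] at this ⊢
    linarith
  · filter_upwards [hval, hn₀, hn₁, hm₀, hm₁] with ξ e0 e1 e2 e3 e4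
    simp only [Pi.add_apply, Pi.sub_apply]
    rw [e0]
    rw [← Complex.coe_smul] at e1 e2
    have s0 := h₀.slice (ξ : Cn m)
    have s1 := h₁.slice (ξ : Cn m)
    have p0 := log_norm_le_circleAverage_poissonKernel s0 ha' e1
    have p1 := log_norm_le_circleAverage_poissonKernel s1 hb' e4
    have p2 := log_norm_quotient_le s0 s1 hR ha hb e3 e2
    rw [hna, hnb] at p2
    simp only [Complex.coe_smul] at p0 p1 p2
    -- The majorant is a kernel term plus two Poisson defects, all nonnegative, so replacing log by
    -- log⁺ costs nothing.
    refine max_le ?_ ?_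
    · have : 0 ≤ Real.circleAverage (fun w : ℂ =>
          |Real.log ‖f₀ (w • (ξ : Cn m))‖ - Real.log ‖f₁ (w • (ξ : Cn m))‖|) 0 R :=
        Real.circleAverage_nonneg_of_nonneg fun z _ => abs_nonneg _
      have := mul_nonneg (show 0 ≤ 4 * (r + ‖q‖ * r) / R by positivity) this
      linarith
    · linarith

end Means

/-! ### Logarithmic density and slow variation. -/

lemma integrableOn_inv_Icc (r : ℝ) : IntegrableOn (fun t : ℝ => t⁻¹) (Set.Icc 1 r) := by
  refine ContinuousOn.integrableOn_Icc (continuousOn_inv₀.mono ?_)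
  intro t ht
  have := ht.1
  simp only [Set.mem_compl_iff, Set.mem_singleton_iff]
  linarith

lemma integral_inv_Icc {r : ℝ} (hr : 1 ≤ r) : ∫ t in Set.Icc 1 r, t⁻¹ = Real.log r := by
  rw [integral_Icc_eq_integral_Ioc, ← intervalIntegral.integral_of_le hr,
    integral_inv_of_pos one_pos (by linarith), div_one]

lemma setIntegral_inv_mono {E F : Set ℝ} {r : ℝ} (h : E ∩ Set.Icc 1 r ⊆ F ∩ Set.Icc 1 r) :
    ∫ t in E ∩ Set.Icc 1 r, t⁻¹ ≤ ∫ t in F ∩ Set.Icc 1 r, t⁻¹ := by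
  refine setIntegral_mono_set ((integrableOn_inv_Icc r).mono_set Set.inter_subset_right) ?_
    h.eventuallyLE
  refine ae_restrict_of_ae_restrict_of_subset Set.inter_subset_right
    ((ae_restrict_mem measurableSet_Icc).mono fun t ht => ?_)
  exact inv_nonneg.2 (by linarith [ht.1])

lemma setIntegral_inv_nonneg {E : Set ℝ} (hE : MeasurableSet E) (r : ℝ) :
    0 ≤ ∫ t in E ∩ Set.Icc 1 r, t⁻¹ :=
  setIntegral_nonneg (hE.inter measurableSet_Icc) fun t ht => inv_nonneg.2 (by linarith [ht.2.1])

lemma HasLogDensity.compl {E : Set ℝ} (h : HasLogDensity E 0) : HasLogDensity Eᶜ 1 := by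
  refine ⟨h.1.compl, ?_⟩
  have h1 := h.2.const_sub 1
  rw [sub_zero] at h1
  refine h1.congr' ?_
  filter_upwards [eventually_gt_atTop 1] with r hr
  have hlog : Real.log r ≠ 0 := (Real.log_pos hr).ne'
  have hsum := integral_inter_add_sdiff (μ := volume) (f := fun t : ℝ => t⁻¹) (s := Set.Icc 1 r) h.1
    (integrableOn_inv_Icc r)
  rw [integral_inv_Icc hr.le, Set.inter_comm, Set.sdiff_eq, Set.inter_comm _ Eᶜ] at hsum
  rw [← eq_sub_iff_add_eq'] at hsum
  rw [hsum, sub_div, div_self hlog]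

/-- A sequence of increasing sets of logarithmic density zero is eventually contained in a single
set of logarithmic density zero. -/
lemma exists_hasLogDensity_zero_of_monotone {E : ℕ → Set ℝ} (hE : Monotone E)
    (hd : ∀ n, HasLogDensity (E n) 0) :
    ∃ F, HasLogDensity F 0 ∧ ∀ n, ∃ R : ℝ, ∀ s, R ≤ s → s ∈ E n → s ∈ F := by
  have h1 : ∀ n : ℕ, ∃ a : ℝ, ∀ r, a ≤ r →
      (∫ t in E n ∩ Set.Icc 1 r, t⁻¹) / Real.log r < 1 / ((n : ℝ) + 1) := by
    intro n
    have := (hd n).2.eventually (gt_mem_nhds (show (0 : ℝ) < 1 / ((n : ℝ) + 1) by positivity))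
    exact eventually_atTop.1 this
  choose a ha using h1
  -- The sum puts `R n` beyond `a n`; the summand `n` leaves only finitely many `k` with `R k ≤ r`.
  set R : ℕ → ℝ := fun n => n + ∑ i ∈ Finset.range (n + 1), |a i|
  have hRa : ∀ n, a n ≤ R n := fun n => by
    have h2 := Finset.single_le_sum (f := fun i => |a i|) (fun i _ => abs_nonneg (a i))
      (Finset.self_mem_range_succ n)
    have h3 := le_abs_self (a n)
    have h4 : (0 : ℝ) ≤ n := Nat.cast_nonneg n
    simp only [R]
    linarith
  have hRn : ∀ n : ℕ, (n : ℝ) ≤ R n := fun n =>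
    le_add_of_nonneg_right (Finset.sum_nonneg fun i _ => abs_nonneg _)
  set F := ⋃ n, E n ∩ Set.Ici (R n) with hF
  have hFm : MeasurableSet F := MeasurableSet.iUnion fun n => (hd n).1.inter measurableSet_Ici
  refine ⟨F, ⟨hFm, ?_⟩, fun n => ⟨R n, fun s hs hsE => Set.mem_iUnion.2 ⟨n, hsE, hs⟩⟩⟩
  have hbound : ∀ n : ℕ, ∀ r, max 1 (R n) ≤ r →
      (∫ t in F ∩ Set.Icc 1 r, t⁻¹) / Real.log r ≤ 1 / ((n : ℝ) + 1) := by
    intro n r hr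
    have hr1 : 1 ≤ r := (le_max_left _ _).trans hr
    have hrn : R n ≤ r := (le_max_right _ _).trans hr
    classical
    -- Up to `r` only the pieces with index at most `N` occur, and by monotonicity all of them lie
    -- in `E N`.
    set N := Nat.findGreatest (fun k => R k ≤ r) ⌈r⌉₊
    have hle : ∀ k, R k ≤ r → k ≤ ⌈r⌉₊ := fun k hk => by
      exact_mod_cast ((hRn k).trans hk).trans (Nat.le_ceil r)
    have hnN : n ≤ N := Nat.le_findGreatest (hle n hrn) hrn
    have hN : R N ≤ r := Nat.findGreatest_spec (P := fun k => R k ≤ r) (hle n hrn) hrn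
    have hsub : F ∩ Set.Icc 1 r ⊆ E N ∩ Set.Icc 1 r := by
      rintro s ⟨hs, hsr⟩
      obtain ⟨k, hk, hkR⟩ := Set.mem_iUnion.1 hs
      have hkr : R k ≤ r := le_trans hkR hsr.2
      exact ⟨hE (Nat.le_findGreatest (hle k hkr) hkr) hk, hsr⟩
    have h3 := (ha N r ((hRa N).trans hN)).le
    have h4 : (∫ t in F ∩ Set.Icc 1 r, t⁻¹) / Real.log r ≤
        (∫ t in E N ∩ Set.Icc 1 r, t⁻¹) / Real.log r :=
      div_le_div_of_nonneg_right (setIntegral_inv_mono hsub) (Real.log_nonneg hr1)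
    refine (h4.trans h3).trans ?_
    gcongr
  rw [Metric.tendsto_atTop]
  intro ε hε
  obtain ⟨n, hn⟩ := exists_nat_one_div_lt hε
  refine ⟨max 1 (R n), fun r hr => ?_⟩
  have h5 := hbound n r hr
  have h6 : 0 ≤ (∫ t in F ∩ Set.Icc 1 r, t⁻¹) / Real.log r :=
    div_nonneg (setIntegral_inv_nonneg hFm r) (Real.log_nonneg ((le_max_left _ _).trans hr))
  rw [Real.dist_eq, sub_zero, abs_of_nonneg h6]
  linarith

lemma Monotone.intervalIntegrable_mul_inv {G : ℝ → ℝ} (hG : Monotone G) {a b : ℝ} (ha : 0 < a)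
    (hb : 0 < b) : IntervalIntegrable (fun s => G s * s⁻¹) volume a b := by
  refine (hG.intervalIntegrable).mul_continuousOn (continuousOn_inv₀.mono ?_)
  intro s hs
  have : 0 < s := (lt_min ha hb).trans_le hs.1
  simpa using this.ne'

/-- The logarithmic mean of the increments `G (K s) - G s` of a monotone function. -/
lemma Monotone.integral_increment_le {G : ℝ → ℝ} (hG : Monotone G) (hG0 : ∀ s, 0 ≤ G s) {K r : ℝ}
    (hK : 1 ≤ K) (hr : 1 ≤ r) :
    ∫ s in (1 : ℝ)..r, (G (K * s) - G s) * s⁻¹ ≤ Real.log K * G (K * r) := by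
  have hK0 : 0 < K := by linarith
  have hr0 : 0 < r := by linarith
  have hKr : 0 < K * r := mul_pos hK0 hr0
  have hGK : Monotone fun s => G (K * s) := fun s t h => hG (by gcongr)
  simp_rw [sub_mul]
  rw [intervalIntegral.integral_sub (hGK.intervalIntegrable_mul_inv one_pos hr0)
    (hG.intervalIntegrable_mul_inv one_pos hr0)]
  -- Scale invariance of ds/s: the difference telescopes to the integral over [r, Kr] minus the
  -- nonnegative one over [1, K].
  have h1 : ∫ s in (1 : ℝ)..r, G (K * s) * s⁻¹ = ∫ s in K..(K * r), G s * s⁻¹ := by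
    have h2 := intervalIntegral.mul_integral_comp_mul_left (f := fun s => G s * s⁻¹) (a := 1)
      (b := r) K
    rw [mul_one] at h2
    rw [← h2, ← intervalIntegral.integral_const_mul]
    refine intervalIntegral.integral_congr fun s _ => ?_
    simp only [mul_inv]
    field_simp
  have h3 := intervalIntegral.integral_interval_sub_interval_comm (μ := volume)
    (hG.intervalIntegrable_mul_inv hK0 hKr) (hG.intervalIntegrable_mul_inv one_pos hr0)
    (hG.intervalIntegrable_mul_inv hK0 one_pos)
  have h4 : 0 ≤ ∫ s in (1 : ℝ)..K, G s * s⁻¹ :=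
    intervalIntegral.integral_nonneg hK fun s hs =>
      mul_nonneg (hG0 s) (inv_nonneg.2 (by linarith [hs.1]))
  have h5 : ∫ s in r..(K * r), G s * s⁻¹ ≤ ∫ s in r..(K * r), G (K * r) * s⁻¹ := by
    have hle : r ≤ K * r := by nlinarith
    refine intervalIntegral.integral_mono_on hle (hG.intervalIntegrable_mul_inv hr0 hKr)
      ((monotone_const (c := G (K * r))).intervalIntegrable_mul_inv hr0 hKr) fun s hs => ?_
    exact mul_le_mul_of_nonneg_right (hG hs.2) (inv_nonneg.2 (by linarith [hs.1]))
  rw [intervalIntegral.integral_const_mul, integral_inv_of_pos hr0 hKr,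
    mul_div_cancel_right₀ _ hr0.ne'] at h5
  have h6 : ∫ s in K..(K * r), G s * s⁻¹ = (∫ s in K..(1 : ℝ), G s * s⁻¹)
      + (∫ s in (1 : ℝ)..r, G s * s⁻¹) + ∫ s in r..(K * r), G s * s⁻¹ := by
    rw [intervalIntegral.integral_add_adjacent_intervals
      (hG.intervalIntegrable_mul_inv hK0 one_pos) (hG.intervalIntegrable_mul_inv one_pos hr0),
      intervalIntegral.integral_add_adjacent_intervals
      (hG.intervalIntegrable_mul_inv hK0 hr0) (hG.intervalIntegrable_mul_inv hr0 hKr)]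
  rw [intervalIntegral.integral_symm 1 K] at h6
  rw [h1]
  linarith [mul_comm (G (K * r)) (Real.log K)]

/-- Chebyshev's inequality for dt/t: up to radius r the set has logarithmic measure at most δ⁻¹ log
K · G(Kr), which is o(log r). -/
lemma hasLogDensity_zero_of_isLittleO_log {G : ℝ → ℝ} (hG : Monotone G) (hG0 : ∀ s, 0 ≤ G s)
    (hGo : G =o[atTop] Real.log) {K δ : ℝ} (hK : 1 ≤ K) (hδ : 0 < δ) :
    HasLogDensity {s | δ < G (K * s) - G s} 0 := by
  have hK0 : 0 < K := by linarith
  have hGK : Monotone fun s => G (K * s) := fun s t h => hG (by gcongr)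
  have hm : MeasurableSet {s | δ < G (K * s) - G s} :=
    measurableSet_lt measurable_const (hGK.measurable.sub hG.measurable)
  refine ⟨hm, ?_⟩
  have hbound : ∀ r, 1 ≤ r →
      ∫ t in {s | δ < G (K * s) - G s} ∩ Set.Icc 1 r, t⁻¹ ≤ δ⁻¹ * (Real.log K * G (K * r)) := by
    intro r hr
    have hr0 : 0 < r := by linarith
    set E := {s | δ < G (K * s) - G s} ∩ Set.Icc 1 r
    have hEm : MeasurableSet E := hm.inter measurableSet_Icc
    have hI : IntegrableOn (fun s => (G (K * s) - G s) * s⁻¹) (Set.Icc 1 r) := by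
      have h1 := (hGK.intervalIntegrable_mul_inv one_pos hr0).sub
        (hG.intervalIntegrable_mul_inv one_pos hr0)
      have h2 := (intervalIntegrable_iff_integrableOn_Icc_of_le hr).1 h1
      refine h2.congr_fun (fun s _ => ?_) measurableSet_Icc
      simp only [sub_mul]
    have h1 : ∫ t in E, δ * t⁻¹ ≤ ∫ t in E, (G (K * t) - G t) * t⁻¹ := by
      refine setIntegral_mono_on (((integrableOn_inv_Icc r).mono_set
        Set.inter_subset_right).const_mul δ) (hI.mono_set Set.inter_subset_right) hEm fun t ht => ?_
      exact mul_le_mul_of_nonneg_right (le_of_lt ht.1) (inv_nonneg.2 (by linarith [ht.2.1]))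
    have h2 : ∫ t in E, (G (K * t) - G t) * t⁻¹ ≤ ∫ t in Set.Icc 1 r, (G (K * t) - G t) * t⁻¹ := by
      refine setIntegral_mono_set hI ?_ (Set.inter_subset_right).eventuallyLE
      refine (ae_restrict_mem measurableSet_Icc).mono fun t ht => ?_
      have ht0 : 0 ≤ t := by linarith [ht.1]
      refine mul_nonneg (sub_nonneg.2 (hG ?_)) (inv_nonneg.2 ht0)
      nlinarith
    have h3 := hG.integral_increment_le hG0 hK hr
    rw [intervalIntegral.integral_of_le hr, ← integral_Icc_eq_integral_Ioc] at h3
    rw [integral_const_mul] at h1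
    rw [le_inv_mul_iff₀ hδ]
    linarith
  have ho : (fun r => G (K * r)) =o[atTop] Real.log := by
    have h1 := hGo.comp_tendsto (tendsto_id.const_mul_atTop hK0)
    refine h1.trans_isBigO ?_
    have h2 : (fun _ : ℝ => Real.log K) =O[atTop] Real.log :=
      (isLittleO_const_left.2 (Or.inr (tendsto_norm_atTop_atTop.comp Real.tendsto_log_atTop))).isBigO
    refine (h2.add (isBigO_refl Real.log atTop)).congr' ?_ EventuallyEq.rfl
    filter_upwards [eventually_gt_atTop 0] with r hr
    simp only [Function.comp, id]
    rw [Real.log_mul hK0.ne' hr.ne']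
  have h4 := (ho.const_mul_left (Real.log K)).const_mul_left δ⁻¹
  refine squeeze_zero' ?_ ?_ h4.tendsto_div_nhds_zero
  · filter_upwards [eventually_ge_atTop 1] with r hr
    exact div_nonneg (setIntegral_inv_nonneg hm r) (Real.log_nonneg hr)
  · filter_upwards [eventually_ge_atTop 1] with r hr
    exact div_le_div_of_nonneg_right (hbound r hr) (Real.log_nonneg hr)

/-- A monotone function of order zero is slowly varying along a set of logarithmic density one. -/
lemma exists_hasLogDensity_one_le_two_mul {T : ℝ → ℝ} (hT : ∀ r s, 1 ≤ r → r ≤ s → T r ≤ T s)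
    (htop : Tendsto T atTop atTop)
    (hord : ∀ ε > 0, ∀ᶠ r in atTop, Real.log (T r) ≤ ε * Real.log r) :
    ∃ A, HasLogDensity A 1 ∧ ∀ K, 1 ≤ K → ∀ᶠ r in atTop ⊓ 𝓟 A, T (K * r) ≤ 2 * T r := by
  -- A truncation of log T that is nonnegative and monotone on the whole line and agrees with log T
  -- for large s.
  set G : ℝ → ℝ := fun s => Real.log (max 1 (T (max 1 s)))
  have hG : Monotone G := fun s t h =>
    Real.log_le_log (by positivity) (max_le_max le_rfl
      (hT _ _ (le_max_left _ _) (max_le_max le_rfl h)))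
  have hG0 : ∀ s, 0 ≤ G s := fun s => Real.log_nonneg (le_max_left _ _)
  have hGT : ∀ᶠ s in atTop, G s = Real.log (T s) := by
    filter_upwards [eventually_ge_atTop 1, htop.eventually_ge_atTop 1] with s hs hTs
    simp only [G, max_eq_right hs, max_eq_right hTs]
  have hGo : G =o[atTop] Real.log := by
    rw [isLittleO_iff]
    intro c hc
    filter_upwards [hGT, hord c hc, eventually_ge_atTop 1] with s h1 h2 h3
    rw [Real.norm_eq_abs, Real.norm_eq_abs, abs_of_nonneg (hG0 s),
      abs_of_nonneg (Real.log_nonneg h3), h1]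
    exact h2
  -- Where T((n+1)s) > 2T(s), for large s. Integer ratios suffice, so countably many exceptional
  -- sets merge into one that serves every K.
  set E : ℕ → Set ℝ := fun n => {s | Real.log 2 < G ((n + 1 : ℝ) * s) - G s}
  have hlog2 : 0 < Real.log 2 := Real.log_pos one_lt_two
  have hE : Monotone E := by
    intro n k hnk s hs
    have hs : Real.log 2 < G ((n + 1 : ℝ) * s) - G s := hs
    change Real.log 2 < G ((k + 1 : ℝ) * s) - G s
    have hn : (0 : ℝ) ≤ n := Nat.cast_nonneg n
    rcases le_or_gt 0 s with h0 | h0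
    · have : G ((n + 1 : ℝ) * s) ≤ G ((k + 1 : ℝ) * s) := hG (by gcongr)
      linarith
    · have : G ((n + 1 : ℝ) * s) ≤ G s := hG (by nlinarith)
      linarith
  obtain ⟨F, hF, hEF⟩ := exists_hasLogDensity_zero_of_monotone hE fun n =>
    hasLogDensity_zero_of_isLittleO_log hG hG0 hGo
      (le_add_of_nonneg_left (Nat.cast_nonneg n)) hlog2
  refine ⟨Fᶜ, hF.compl, fun K hK => ?_⟩
  obtain ⟨n, hn⟩ := exists_nat_ge K
  obtain ⟨R, hR⟩ := hEF n
  rw [eventually_inf_principal]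
  have hn1 : (0 : ℝ) < n + 1 := by positivity
  filter_upwards [eventually_ge_atTop R, eventually_ge_atTop 1, hGT,
    (tendsto_id.const_mul_atTop hn1).eventually hGT, htop.eventually_ge_atTop 1]
    with s hsR hs1 h1 h2 hT1 hsF
  have h3 : s ∉ E n := fun h => hsF (hR s hsR h)
  have h3 : G ((n + 1 : ℝ) * s) - G s ≤ Real.log 2 := not_lt.1 h3
  have h4 : T (K * s) ≤ T ((n + 1 : ℝ) * s) := hT _ _ (by nlinarith) (by nlinarith)
  have h5 : T s ≤ T ((n + 1 : ℝ) * s) := hT _ _ hs1 (by nlinarith)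
  simp only [id] at h2
  rw [h1, h2, sub_le_iff_le_add, ← Real.log_mul two_ne_zero (by linarith)] at h3
  exact h4.trans ((Real.log_le_log_iff (by linarith) (by linarith)).1 h3)

/-! ### A bounded characteristic forces a constant quotient. -/

/-- If g(0) = 0, then log|g| < M − 1 near the origin, so the means over small spheres fall below M.
-/
lemma IsEntire.apply_zero_ne_zero_of_sphereMean_eq {m : ℕ} [NeZero m] {g : Cn m → ℂ}
    (hg : IsEntire g) (hne : ∃ z, g z ≠ 0) {M : ℝ}
    (hM : ∀ r, 0 < r → sphereMean (fun z => Real.log ‖g z‖) r = M) : g 0 ≠ 0 := by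
  intro h0
  have hc : ContinuousAt (fun z => ‖g z‖) 0 := hg.continuous.norm.continuousAt
  have hev : ∀ᶠ z in 𝓝 (0 : Cn m), ‖g z‖ < Real.exp (M - 1) :=
    hc.eventually (gt_mem_nhds (by simp [h0, Real.exp_pos]))
  obtain ⟨δ, hδ, hball⟩ := Metric.eventually_nhds_iff.1 hev
  have hr : 0 < δ / 2 := by linarith
  obtain ⟨hI, hn⟩ := hg.sphereIntegrable_log_norm_and_ae_ne_zero hne hr
  have h1 : sphereMean (fun z => Real.log ‖g z‖) (δ / 2) ≤
      ∫ _ : Metric.sphere (0 : Cn m) 1, (M - 1) ∂(sphereMeasure m) := by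
    refine integral_le_integral_of_ae_le hI (integrable_const _) ?_
    filter_upwards [hn] with ξ hξ
    rw [Real.log_le_iff_le_exp (norm_pos_iff.2 hξ)]
    refine (hball ?_).le
    rw [dist_zero_right, norm_smul, Real.norm_eq_abs, abs_of_pos hr]
    simp only [norm_eq_of_mem_sphere, mul_one]
    linarith
  rw [hM _ hr] at h1
  simp at h1
  linarith

/-- If the characteristic function is bounded, then the quotient is constant. -/
lemma exists_eq_const_mul_of_sphereMean_le {m : ℕ} [NeZero m] {f₀ f₁ : Cn m → ℂ}
    (h₀ : IsEntire f₀) (h₁ : IsEntire f₁) (n₀ : ∃ z, f₀ z ≠ 0) (n₁ : ∃ z, f₁ z ≠ 0) {B : ℝ}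
    (hB : ∀ r, 0 < r → sphereMean (fun z => Real.log (√(‖f₀ z‖ ^ 2 + ‖f₁ z‖ ^ 2))) r ≤ B) :
    ∃ c : ℂ, ∀ z, f₀ z = c * f₁ z := by
  -- A convex function of log r bounded above on the whole line is constant.
  have hconst : ∀ {g : Cn m → ℂ}, IsEntire g → (∃ z, g z ≠ 0) →
      (∀ r, 0 < r → sphereMean (fun z => Real.log ‖g z‖) r ≤ B) →
      ∀ r, 0 < r → sphereMean (fun z => Real.log ‖g z‖) r =
        sphereMean (fun z => Real.log ‖g z‖) 1 := by
    intro g hg hne hle r hr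
    have := (convexOn_sphereMean_log_norm hg hne).eq_of_forall_le
      (fun t => hle _ (Real.exp_pos t)) (Real.log r) 0
    rwa [Real.exp_log hr, Real.exp_zero] at this
  have hN₀ := hconst h₀ n₀ fun r hr => (sphereMean_log_norm_le_left h₀ h₁ n₀ n₁ hr).trans (hB r hr)
  have hN₁ := hconst h₁ n₁ fun r hr => (sphereMean_log_norm_le_right h₀ h₁ n₁ hr).trans (hB r hr)
  have h10 : f₁ 0 ≠ 0 := h₁.apply_zero_ne_zero_of_sphereMean_eq n₁ hN₁
  set f : Cn m → ℂ := fun z => f₀ z / f₁ z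
  have hprox : ∀ q : ℂ, q ≠ 0 → ∀ r, 0 < r →
      SphereIntegrable (fun z => Real.posLog ‖f (q • z) / f z‖) r ∧
        proximity (fun z => f (q • z) / f z) r ≤ 0 := by
    intro q hq r hr
    have key := fun {R : ℝ} => proximity_scaling_le (f := f) (R := R) h₀ h₁ n₀ n₁ (fun _ _ => rfl) hq hr
    refine ⟨(key (R := max (2 * r) (2 * (‖q‖ * r))) (le_max_left _ _) (le_max_right _ _)).1, ?_⟩
    set D := 2 * B - sphereMean (fun z => Real.log ‖f₀ z‖) 1 - sphereMean (fun z => Real.log ‖f₁ z‖) 1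
    -- With constant means the increments vanish, and the kernel term tends to 0 as R → ∞; the
    -- proximity function is thus zero for every q.
    have hlim : Tendsto (fun R : ℝ => 4 * (r + ‖q‖ * r) / R * D) atTop (𝓝 (0 * D)) :=
      (tendsto_const_nhds.div_atTop tendsto_id).mul_const D
    rw [zero_mul] at hlim
    refine ge_of_tendsto hlim ?_
    filter_upwards [eventually_ge_atTop (2 * r), eventually_ge_atTop (2 * (‖q‖ * r))] with R h2 h3
    have hR : 0 < R := by linarith
    have hqr : 0 < ‖q‖ * r := mul_pos (norm_pos_iff.2 hq) hr
    have := (key h2 h3).2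
    rw [hN₀ R hR, hN₁ R hR, hN₀ r hr, hN₁ _ hqr, sub_self, sub_self, add_zero, add_zero] at this
    refine this.trans (mul_le_mul_of_nonneg_left ?_ (by positivity))
    have := hB R hR
    simp only [D]
    linarith
  have hineq : ∀ q : ℂ, q ≠ 0 → ∀ z, z ≠ 0 → ‖f₀ (q • z)‖ * ‖f₁ z‖ ≤ ‖f₁ (q • z)‖ * ‖f₀ z‖ := by
    intro q hq z hz
    have hr : 0 < ‖z‖ := norm_pos_iff.2 hz
    have hqr : 0 < ‖q • (‖z‖ : ℂ)‖ := by
      rw [norm_smul]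
      exact mul_pos (norm_pos_iff.2 hq) (by simpa using hz)
    obtain ⟨hI, hle⟩ := hprox q hq _ hr
    have hzero : ∀ᵐ ξ : Metric.sphere (0 : Cn m) 1 ∂(sphereMeasure m),
        Real.posLog ‖f (q • ‖z‖ • (ξ : Cn m)) / f (‖z‖ • (ξ : Cn m))‖ = 0 := by
      have h := (integral_eq_zero_iff_of_nonneg_ae (ae_of_all _ fun ξ => Real.posLog_nonneg) hI).1
        (le_antisymm hle (integral_nonneg fun ξ => Real.posLog_nonneg))
      exact h
    have hae : ∀ᵐ ξ : Metric.sphere (0 : Cn m) 1 ∂(sphereMeasure m),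
        ‖f₀ (q • ‖z‖ • (ξ : Cn m))‖ * ‖f₁ (‖z‖ • (ξ : Cn m))‖ ≤
          ‖f₁ (q • ‖z‖ • (ξ : Cn m))‖ * ‖f₀ (‖z‖ • (ξ : Cn m))‖ := by
      have a0 := (h₀.sphereIntegrable_log_norm_and_ae_ne_zero n₀ hr).2
      have a1 := (h₁.sphereIntegrable_log_norm_and_ae_ne_zero n₁ hr).2
      have a3 := ae_complex_smul (P := fun z => f₁ z ≠ 0)
        (h₁.sphereIntegrable_log_norm_and_ae_ne_zero n₁ hqr).2
      filter_upwards [hzero, a0, a1, a3] with ξ e0 e1 e2 e3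
      have hs : (q • (‖z‖ : ℂ)) • (ξ : Cn m) = q • ‖z‖ • (ξ : Cn m) := by
        rw [smul_assoc, Complex.coe_smul]
      rw [hs] at e3
      rw [Real.posLog_eq_zero_iff, abs_norm] at e0
      simp only [f, norm_div] at e0
      have p1 := norm_pos_iff.2 e1
      have p2 := norm_pos_iff.2 e2
      have p3 := norm_pos_iff.2 e3
      rw [div_le_one (by positivity), div_le_div_iff₀ p3 p2] at e0
      linarith
    -- The inequality between continuous functions holds almost everywhere, hence everywhere:
    -- nonempty open sets have positive measure.
    have hopen : IsOpen {ξ : Metric.sphere (0 : Cn m) 1 |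
        ‖f₁ (q • ‖z‖ • (ξ : Cn m))‖ * ‖f₀ (‖z‖ • (ξ : Cn m))‖ <
        ‖f₀ (q • ‖z‖ • (ξ : Cn m))‖ * ‖f₁ (‖z‖ • (ξ : Cn m))‖} := by
      have c0 := h₀.continuous
      have c1 := h₁.continuous
      exact isOpen_lt (by fun_prop) (by fun_prop)
    have hempty := hopen.eq_empty_of_measure_zero (μ := sphereMeasure m) (by
      rw [ae_iff] at hae
      simpa only [not_le] using hae)
    by_contra! hcon
    have hmem : (⟨‖z‖⁻¹ • z, by simp [norm_smul, hr.ne']⟩ : Metric.sphere (0 : Cn m) 1) ∈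
        {ξ : Metric.sphere (0 : Cn m) 1 |
        ‖f₁ (q • ‖z‖ • (ξ : Cn m))‖ * ‖f₀ (‖z‖ • (ξ : Cn m))‖ <
        ‖f₀ (q • ‖z‖ • (ξ : Cn m))‖ * ‖f₁ (‖z‖ • (ξ : Cn m))‖} := by
      simpa only [Set.mem_ofPred_eq, smul_inv_smul₀ hr.ne'] using hcon
    rw [hempty] at hmem
    exact hmem
  -- Apply `hineq` with ratio 1/w at the point wz and let w → 0. Thus |f| has a maximum at the
  -- origin, and the maximum principle applies.
  have hmax : ∀ z, ‖f₀ z‖ * ‖f₁ 0‖ ≤ ‖f₁ z‖ * ‖f₀ 0‖ := by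
    intro z
    rcases eq_or_ne z 0 with rfl | hz
    · rw [mul_comm]
    have c0 := h₀.continuous
    have c1 := h₁.continuous
    have l0 : Tendsto (fun w : ℂ => ‖f₀ z‖ * ‖f₁ (w • z)‖) (𝓝[≠] 0) (𝓝 (‖f₀ z‖ * ‖f₁ 0‖)) := by
      have : Continuous fun w : ℂ => ‖f₀ z‖ * ‖f₁ (w • z)‖ := by fun_prop
      simpa using (this.tendsto 0).mono_left nhdsWithin_le_nhds
    have l1 : Tendsto (fun w : ℂ => ‖f₁ z‖ * ‖f₀ (w • z)‖) (𝓝[≠] 0) (𝓝 (‖f₁ z‖ * ‖f₀ 0‖)) := by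
      have : Continuous fun w : ℂ => ‖f₁ z‖ * ‖f₀ (w • z)‖ := by fun_prop
      simpa using (this.tendsto 0).mono_left nhdsWithin_le_nhds
    refine le_of_tendsto_of_tendsto l0 l1 ?_
    filter_upwards [self_mem_nhdsWithin] with w hw
    have := hineq w⁻¹ (inv_ne_zero hw) (w • z) (smul_ne_zero hw hz)
    rwa [inv_smul_smul₀ hw] at this
  have hf1 : ∀ᶠ z in 𝓝 (0 : Cn m), f₁ z ≠ 0 := h₁.continuous.continuousAt.eventually_ne h10
  have hdiff : ∀ᶠ z in 𝓝 (0 : Cn m), DifferentiableAt ℂ f z := by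
    filter_upwards [hf1] with z hz
    exact ((h₀ z trivial).div (h₁ z trivial) hz).differentiableAt
  have hloc : IsLocalMax (norm ∘ f) 0 := by
    filter_upwards [hf1] with z hz
    simp only [Function.comp, f, norm_div]
    rw [div_le_div_iff₀ (norm_pos_iff.2 hz) (norm_pos_iff.2 h10)]
    linarith [hmax z]
  have hev := Complex.eventually_eq_of_isLocalMax_norm hdiff hloc
  refine ⟨f 0, fun z => ?_⟩
  have hana : AnalyticOnNhd ℂ (fun z => f 0 * f₁ z) Set.univ := fun z hz => analyticAt_const.mul (h₁ z hz)
  have := AnalyticOnNhd.eqOn_of_preconnected_of_eventuallyEq h₀ hana isPreconnected_univ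
    (Set.mem_univ 0) (by
      filter_upwards [hf1, hev] with z hz he
      rw [← he]
      simp only [f]
      rw [div_mul_cancel₀ _ hz])
  exact this (Set.mem_univ z)

/-! ### Small increments and the conclusion. -/

/-- The point log(κs) lies at fraction 1/L of the segment from log s to log(κ^L s). -/
lemma sub_le_div_of_convexOn_exp {N : ℝ → ℝ}
    (hN : ConvexOn ℝ Set.univ (fun t : ℝ => N (Real.exp t))) {κ s : ℝ} (hκ : 1 ≤ κ) (hs : 0 < s)
    {L : ℕ} (hL : 1 ≤ L) : N (κ * s) - N s ≤ (N (κ ^ L * s) - N s) / L := by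
  have hκ0 : 0 < κ := by linarith
  have hL1 : (1 : ℝ) ≤ L := by exact_mod_cast hL
  have hL0 : (0 : ℝ) < L := by linarith
  have hinv : (1 : ℝ) / L ≤ 1 := (div_le_one hL0).2 hL1
  have h := hN.2 (Set.mem_univ (Real.log s)) (Set.mem_univ (Real.log (κ ^ L * s)))
    (sub_nonneg.2 hinv) (by positivity : (0 : ℝ) ≤ 1 / L) (by ring)
  simp only [smul_eq_mul] at h
  have e : (1 - 1 / (L : ℝ)) * Real.log s + 1 / L * Real.log (κ ^ L * s) = Real.log (κ * s) := by
    rw [Real.log_mul (by positivity) hs.ne', Real.log_mul hκ0.ne' hs.ne', Real.log_pow]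
    field_simp
    ring
  rw [e, Real.exp_log (by positivity), Real.exp_log hs, Real.exp_log (by positivity)] at h
  calc N (κ * s) - N s ≤ (1 - 1 / (L : ℝ)) * N s + 1 / L * N (κ ^ L * s) - N s := by linarith
    _ = _ := by ring

lemma eventually_increment_le {N T : ℝ → ℝ} {C : ℝ} {F : Filter ℝ} (hF : F ≤ atTop)
    (hN : ConvexOn ℝ Set.univ (fun t : ℝ => N (Real.exp t)))
    (hmono : ∀ r s, 0 < r → r ≤ s → N r ≤ N s) (hNT : ∀ s, 0 < s → N s ≤ T s + C)
    (htop : Tendsto T atTop atTop) (hT : ∀ K, 1 ≤ K → ∀ᶠ r in F, T (K * r) ≤ 2 * T r)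
    {ρ κ ε : ℝ} (hρ : 0 < ρ) (hκ : 1 ≤ κ) (hε : 0 < ε) :
    ∀ᶠ r in F, N (κ * (ρ * r)) - N (ρ * r) ≤ ε * T r := by
  -- The long increment is at most T(K'r) + C − N(1) ≤ 3T(r), where K' = max(1, κ^L ρ): doubling
  -- gives 2T(r), and the constant is eventually below T(r).
  obtain ⟨L, hL⟩ := exists_nat_ge (max 1 (3 / ε))
  have hL1 : (1 : ℝ) ≤ L := (le_max_left _ _).trans hL
  have hL3 : 3 ≤ ε * L := by
    have := (le_max_right _ _).trans hL
    rw [div_le_iff₀ hε] at this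
    linarith
  have hκ0 : 0 < κ := by linarith
  filter_upwards [hT _ (le_max_left 1 (κ ^ L * ρ)), hF (eventually_ge_atTop 1),
    hF (eventually_ge_atTop ρ⁻¹), hF (htop.eventually_ge_atTop 0),
    hF (htop.eventually_ge_atTop (C - N 1))] with r h1 hr hr' hT0 hTC
  have hr0 : 0 < r := by linarith
  have hρr : 1 ≤ ρ * r := by
    rw [inv_le_iff_one_le_mul₀ hρ] at hr'
    linarith
  refine (sub_le_div_of_convexOn_exp hN hκ (by positivity) (by exact_mod_cast hL1)).trans ?_
  rw [div_le_iff₀ (by linarith)]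
  have h2 : N (κ ^ L * (ρ * r)) ≤ N (max 1 (κ ^ L * ρ) * r) := by
    refine hmono _ _ (by positivity) ?_
    rw [← mul_assoc]
    exact mul_le_mul_of_nonneg_right (le_max_right _ _) hr0.le
  have h3 := hNT (max 1 (κ ^ L * ρ) * r) (by positivity)
  have h4 := hmono 1 _ one_pos hρr
  have h5 := mul_le_mul_of_nonneg_right hL3 hT0
  linarith

lemma eventually_log_le_of_growthOrder_eq_zero {T : ℝ → ℝ} (h : growthOrder T = 0) {ε : ℝ}
    (hε : 0 < ε) : ∀ᶠ r in atTop, Real.log (T r) ≤ ε * Real.log r := by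
  have hlt : growthOrder T < ((ε : ℝ) : EReal) := by
    rw [h]
    exact_mod_cast hε
  filter_upwards [eventually_lt_of_limsup_lt hlt, eventually_gt_atTop 1] with r hr h1
  have := EReal.coe_lt_coe_iff.1 hr
  rw [div_lt_iff₀ (Real.log_pos h1)] at this
  exact (log_le_posLog _).trans this.le

lemma tendsto_characteristicT {m : ℕ} [NeZero m] {f₀ f₁ : Cn m → ℂ}
    (h₀ : IsEntire f₀) (h₁ : IsEntire f₁) (n₀ : ∃ z, f₀ z ≠ 0) (n₁ : ∃ z, f₁ z ≠ 0)
    (hconst : ¬ ∃ c : ℂ, ∀ z, f₀ z = c * f₁ z) : Tendsto (characteristicT f₀ f₁) atTop atTop := by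
  refine tendsto_atTop.2 fun B => ?_
  have : ∃ r, 0 < r ∧ B ≤ characteristicT f₀ f₁ r := by
    by_contra! hcon
    refine hconst (exists_eq_const_mul_of_sphereMean_le h₀ h₁ n₀ n₁
      (B := B + sphereMean (fun z => Real.log (√(‖f₀ z‖ ^ 2 + ‖f₁ z‖ ^ 2))) 1) fun r hr => ?_)
    have := hcon r hr
    rw [characteristicT] at this
    linarith
  obtain ⟨r, hr, hB⟩ := this
  filter_upwards [eventually_ge_atTop r] with s hs
  exact hB.trans (sub_le_sub_right (sphereMean_log_sqrt_mono h₀ h₁ n₁ hr hs) _)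

lemma isLittleO_proximity_scaling {m : ℕ} [NeZero m] {f f₀ f₁ : Cn m → ℂ}
    (h₀ : IsEntire f₀) (h₁ : IsEntire f₁) (n₀ : ∃ z, f₀ z ≠ 0) (n₁ : ∃ z, f₁ z ≠ 0)
    (hf : ∀ z, f₁ z ≠ 0 → f z = f₀ z / f₁ z) {q : ℂ} (hq : q ≠ 0) {F : Filter ℝ} (hF : F ≤ atTop)
    (htop : Tendsto (characteristicT f₀ f₁) atTop atTop)
    (hT : ∀ K, 1 ≤ K → ∀ᶠ r in F, characteristicT f₀ f₁ (K * r) ≤ 2 * characteristicT f₀ f₁ r) :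
    (fun r : ℝ => proximity (fun z => f (q • z) / f z) r) =o[F] characteristicT f₀ f₁ := by
  set T := characteristicT f₀ f₁
  set S : ℝ → ℝ := sphereMean fun z => Real.log (√(‖f₀ z‖ ^ 2 + ‖f₁ z‖ ^ 2))
  set N₀ : ℝ → ℝ := sphereMean fun z => Real.log ‖f₀ z‖
  set N₁ : ℝ → ℝ := sphereMean fun z => Real.log ‖f₁ z‖
  have hTS : ∀ s, S s = T s + S 1 := fun s => (sub_add_cancel _ _).symm
  have hN₀T : ∀ s, 0 < s → N₀ s ≤ T s + S 1 := fun s hs =>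
    (sphereMean_log_norm_le_left h₀ h₁ n₀ n₁ hs).trans_eq (hTS s)
  have hN₁T : ∀ s, 0 < s → N₁ s ≤ T s + S 1 := fun s hs =>
    (sphereMean_log_norm_le_right h₀ h₁ n₁ hs).trans_eq (hTS s)
  have m₀ : ∀ r s, 0 < r → r ≤ s → N₀ r ≤ N₀ s := fun r s hr hrs => sphereMean_log_norm_mono h₀ n₀ hr hrs
  have m₁ : ∀ r s, 0 < r → r ≤ s → N₁ r ≤ N₁ s := fun r s hr hrs => sphereMean_log_norm_mono h₁ n₁ hr hrs
  have hq0 : 0 < ‖q‖ := norm_pos_iff.2 hq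
  refine isLittleO_iff.2 fun c hc => ?_
  -- The first entry makes R = Kr admissible. In the second, 60 = 4 · 5 · 3: the kernel constant,
  -- the bound 5T(r) for the mean, and the share c/3 of each of three terms.
  set K : ℝ := max (2 * (1 + ‖q‖)) (60 * (1 + ‖q‖) / c)
  have hK2 : 2 * (1 + ‖q‖) ≤ K := le_max_left _ _
  have hKc : 60 * (1 + ‖q‖) ≤ c * K := by
    have : 60 * (1 + ‖q‖) / c ≤ K := le_max_right _ _
    rw [div_le_iff₀ hc] at this
    linarith
  have hK1 : 1 ≤ K := by linarith
  have hK0 : 0 < K := by linarith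
  have hc3 : 0 < c / 3 := by linarith
  have hKq : 1 ≤ K / ‖q‖ := by
    rw [one_le_div hq0]
    linarith
  filter_upwards [
    eventually_increment_le hF (convexOn_sphereMean_log_norm h₀ n₀) m₀ hN₀T htop hT one_pos hK1 hc3,
    eventually_increment_le hF (convexOn_sphereMean_log_norm h₁ n₁) m₁ hN₁T htop hT hq0 hKq hc3,
    hT K hK1, hF (eventually_ge_atTop 1), hF (htop.eventually_ge_atTop 0),
    hF (htop.eventually_ge_atTop (2 * S 1 - N₀ 1 - N₁ 1))] with r i₀ i₁ hTK hr hT0 hTC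
  have hr0 : 0 < r := by linarith
  have hrR : 2 * r ≤ K * r := mul_le_mul_of_nonneg_right (by linarith) hr0.le
  have hqR : 2 * (‖q‖ * r) ≤ K * r := by
    rw [← mul_assoc]
    exact mul_le_mul_of_nonneg_right (by linarith) hr0.le
  have main := (proximity_scaling_le h₀ h₁ n₀ n₁ hf hq hr0 hrR hqR).2
  change _ ≤ 4 * (r + ‖q‖ * r) / (K * r) * (2 * S (K * r) - N₀ (K * r) - N₁ (K * r))
    + (N₀ (K * r) - N₀ r) + (N₁ (K * r) - N₁ (‖q‖ * r)) at main
  rw [one_mul] at i₀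
  have e1 : K / ‖q‖ * (‖q‖ * r) = K * r := by
    field_simp
  rw [e1] at i₁
  have e2 : 4 * (r + ‖q‖ * r) / (K * r) = 4 * (1 + ‖q‖) / K := by
    field_simp
  have hKr : 1 ≤ K * r := by nlinarith
  have b₀ := m₀ 1 _ one_pos hKr
  have b₁ := m₁ 1 _ one_pos hKr
  have b₂ := hTS (K * r)
  have hfirst : 4 * (1 + ‖q‖) / K * (2 * S (K * r) - N₀ (K * r) - N₁ (K * r)) ≤ c / 3 * T r := by
    have hle : 2 * S (K * r) - N₀ (K * r) - N₁ (K * r) ≤ 5 * T r := by linarith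
    refine (mul_le_mul_of_nonneg_left hle (by positivity)).trans ?_
    rw [← mul_assoc]
    refine mul_le_mul_of_nonneg_right ?_ hT0
    rw [div_mul_eq_mul_div, div_le_iff₀ hK0]
    linarith
  have hnonneg : 0 ≤ proximity (fun z => f (q • z) / f z) r :=
    integral_nonneg fun ξ => Real.posLog_nonneg
  rw [Real.norm_of_nonneg hnonneg, Real.norm_of_nonneg hT0]
  rw [e2] at main
  linarith

theorem mainTheorem2 (m : ℕ) (f f₀ f₁ : Cn m → ℂ)
    (hf : IsReducedRepresentation f f₀ f₁)
    (hnonconst : ¬ ∃ c : ℂ, ∀ z, f₁ z ≠ 0 → f z = c)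
    (horder : growthOrder (characteristicT f₀ f₁) = 0)
    (q : ℂ) (hq : q ≠ 0) :
    (∀ r : ℝ, 0 < r →
      SphereIntegrable (fun z => Real.posLog ‖f (q • z) / f z‖) r) ∧
    ∃ A : Set ℝ, HasLogDensity A 1 ∧
      (fun r : ℝ => proximity (fun z => f (q • z) / f z) r)
        =o[atTop ⊓ 𝓟 A] (fun r : ℝ => characteristicT f₀ f₁ r) := by
  have h₀ := hf.entire_num
  have h₁ := hf.entire_den
  have n₁ := hf.den_ne_zero
  -- On the one-point space ℂ⁰ every function is constant, so m ≥ 1.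
  have hm : NeZero m := by
    refine ⟨?_⟩
    rintro rfl
    exact hnonconst ⟨f 0, fun z _ => congrArg f (Subsingleton.elim z 0)⟩
  have hconst : ¬ ∃ c : ℂ, ∀ z, f₀ z = c * f₁ z := by
    rintro ⟨c, hc⟩
    refine hnonconst ⟨c, fun z hz => ?_⟩
    rw [hf.eq_div z hz, hc z, mul_div_cancel_right₀ _ hz]
  have n₀ : ∃ z, f₀ z ≠ 0 := by
    by_contra! h
    exact hconst ⟨0, fun z => by rw [h z, zero_mul]⟩
  have htop := tendsto_characteristicT h₀ h₁ n₀ n₁ hconst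
  refine ⟨fun r hr => (proximity_scaling_le h₀ h₁ n₀ n₁ hf.eq_div hq hr
    (le_max_left _ (2 * (‖q‖ * r))) (le_max_right _ _)).1, ?_⟩
  obtain ⟨A, hA, hT⟩ := exists_hasLogDensity_one_le_two_mul
    (fun r s hr hrs => sub_le_sub_right
      (sphereMean_log_sqrt_mono h₀ h₁ n₁ (one_pos.trans_le hr) hrs) _) htop
    (fun ε hε => eventually_log_le_of_growthOrder_eq_zero horder hε)
  exact ⟨A, hA, isLittleO_proximity_scaling h₀ h₁ n₀ n₁ hf.eq_div hq inf_le_left htop hT⟩
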